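/- **Setting.** Fix a finite set $P$ of processes, a set $\mathsf{Var}$ of shared variables and a set $\mathsf{Val}$ of values with a distinguished initial value $0$. A memory action is a write $W(x,v)$, a read $R(x,v)$, a read-modify-write $RMW(x,v_{old},v_{new})$ or a fence $F$; a memory event is a pair (process, memory action). A memory model $M$ is a labelled transition system (LTS) with an initial state, whose labels are the memory events and a silent step $\tau$. A trace of an LTS is the label sequence of a finite execution from the initial state; $OTr(M)$ is the set of traces of $M$ with all $\tau$ removed. The following are memory models. * SCM: states $m:\mathsf{Var}\to\mathsf{Val}$, initially constantly $0$. $W(x,v)$ sets $m(x):=v$; $R(x,v)$ requires $m(x)=v$; $RMW(x,v_{old},v_{new})$ requires $m(x)=v_{old}$ and sets $m(x):=v_{new}$; $F$ does nothing. * TSO: states $(m,b)$ with a main memory $m$, initially constantly $0$, and a FIFO store buffer $b(p)\in(\mathsf{Var}\times\mathsf{Val})^*$ for every process, initially empty. A write $W(x,v)$ by $p$ appends $(x,v)$ to $b(p)$; a read of $x$ by $p$ returns the value of the last entry for $x$ in $b(p)$, or $m(x)$ if there is none; $RMW$ and $F$ by $p$ require $b(p)$ to be empty and then act on $m$ as in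 SCM; a $\tau$ step removes the first entry $(x,v)$ of some buffer and sets $m(x):=v$. * RA: states $(m,\mathcal V,V_f)$ with a set $m$ of messages $(x,v,t,V)$ (variable, value, timestamp $t\in\mathbb N$, view $V:\mathsf{Var}\to\mathbb N$), a view $\mathcal V(p)$ for every process, and a fence view $V_f$. Initially $m=\{(x,0,0,\lambda y.0) : x\in\mathsf{Var}\}$ and all views are constantly $0$. $W(x,v)$ by $p$ chooses $t>\mathcal V(p)(x)$ that is the timestamp of no message of $x$, sets $\mathcal V(p)(x):=t$ and adds $(x,v,t,\mathcal V(p))$ with the updated view. $R(x,v)$ by $p$ requires a message $(x,v,\mathcal V(p)(x),\_)\in m$. $RMW(x,v_{old},v_{new})$ by $p$ requires a message $(x,v_{old},\mathcal V(p)(x),\_)\in m$ and acts like the write $W(x,v_{new})$ with $t=\mathcal V(p)(x)+1$, which must be unused for $x$. $F$ by $p$ sets both $\mathcal V(p)$ and $V_f$ to the pointwise maximum $\mathcal V(p)\sqcup V_f$. A $\tau$ step picks a process $p$ and a message $(x,v,t,V)\in m$ with $\mathcal V(p)(x)<t$ and sets $\mathcal V(p):=\mathcal V(p)\sqcup V$.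 **Objects.** An object $O$ has a set of operations and a set of responses. A history is a finite sequence of pairs (process, action), where an action is an invocation $inv(o)$ or a response $res(u)$. Let $\langle p,o,u\rangle$ denote the history $(p,inv(o)),(p,res(u))$. A history is sequential if it is a prefix of a concatenation of such two-event histories, well-formed if its restriction to each process is sequential, and complete if it is well-formed and its restriction to each process is empty or ends with a response. $O$ comes with a specification $\mathrm{Spec}(O)$: a set of complete sequential histories that contains every complete sequential prefix of each of its members. $O$ is deterministic if no two histories in $\mathrm{Spec}(O)$ have a longest common prefix that ends with an invocation. Operations $o_1,o_2$ are strongly (that is, two-sided) non-commutative if there are a complete sequential history $h_0$, processes $p_1\ne p_2$ and responses $u_1\neq v_1$, $u_2\ne v_2$ with $h_0\cdot\langle p_1,o_1,u_1\rangle\cdot\langle p_2,o_2,v_2\rangle\in\mathrm{Spec}(O)$ and $h_0\cdot\langle p_2,o_2,u_2\rangle\cdot\langle p_1,o_1,v_1\rangle\in\mathrm{Spec}(O)$. **Implementations.** An implementation $I$ of $O$ assigns to each operation $o$ and process $p$ an LTS $I(o,p)$ whose labels are (memory or object) events of $p$ and in which no transition is enabled after a response. $Tr(I)$ is the set of traces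 of the system in which every process repeatedly invokes an arbitrary operation $o$, performs memory events as prescribed by $I(o,p)$ from its initial state, and becomes idle again after a response transition of $I(o,p)$, the steps of the processes being interleaved arbitrarily. Write $\pi|_{mem}$ and $\pi|_{obj}$ for the restrictions of an event sequence $\pi$ to memory events and to object events. A history $h$ is generated by $I$ after $\pi_0$ under $M$ if $h=\pi|_{obj}$ for some $\pi$ with $\pi_0\cdot\pi\in Tr(I)$ and $(\pi_0\cdot\pi)|_{mem}\in OTr(M)$. A history $h'$ linearizes $h$ if it is a permutation of the events of $h$ that preserves the order of any two events of the same process and the order of every response before every later invocation. $I$ is consistent under $M$ if every complete history generated by $I$ (after the empty sequence) under $M$ is linearized by some history in $\mathrm{Spec}(O)$. $I$ is spec-available if for all complete sequential histories $h_0,h$ with $h_0\cdot h\in\mathrm{Spec}(O)$ and every $\pi_0\in Tr(I)$ with $\pi_0|_{mem}\in OTr(\mathrm{SCM})$ and $\pi_0|_{obj}=h_0$, the history $h$ is generated by $I$ after $\pi_0$ under SCM. **Patterns.** A sequence $\sigma$ of memory events is RBW (read-before-write) if whenever $k_1<k_2$, $\sigma[k_1]$ is a write, $\sigma[k_2]$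 is a read, and they access different variables, there is $k_1<k<k_2$ such that $\sigma[k]$ is a write to the variable read by $\sigma[k_2]$. It is LF (resp. TF) if no fence in it is immediately preceded (resp. followed) by an event that is not a fence, and LTF if $\sigma=\sigma'\cdot\sigma''$ for some LF $\sigma'$ and some TF $\sigma''$ (so all fences are at the beginning or at the end). **Theorem.** Let $O$ be a deterministic object with a pair of strongly non-commutative operations $o_1,o_2$, and let $I$ be a spec-available implementation of $O$ that is consistent under a memory model $M$. Then there exist a process $p_1$ and a trace $\pi_1$ of $I(o_1,p_1)$ such that the following hold for $\sigma_1=\pi_1|_{mem}$: (a) if $M=\mathrm{SCM}$, then $\sigma_1$ has an RMW or is not RBW; and (b) if $M\in\{\mathrm{TSO},\mathrm{RA}\}$, then $\sigma_1$ has an RMW or is not LTF (that is, it has a fence in the middle). -/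

import Mathlib

universe u v w z

/-! ### Labelled transition systems -/

/-- A labelled transition system with labels in `L`. -/
structure LTS (L : Type u) where
  State : Type v
  init : State
  Trans : State → L → State → Prop

namespace LTS

variable {L : Type u}

/-- `A.Run q π q'`: some execution fragment from `q` to `q'` has trace `π`. -/
def Run (A : LTS.{u, v} L) : A.State → List L → A.State → Prop
  | q, [], q' => q = q'
  | q, l :: π, q' => ∃ r, A.Trans q l r ∧ A.Run r π q'

/-- Traces of execution fragments that start from the state `q`. -/
def tracesFrom (A : LTS.{u, v} L) (q : A.State) : Set (List L) :=
  {π | ∃ q', A.Run q π q'}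

/-- Traces of executions (they start from the initial state). -/
def traces (A : LTS.{u, v} L) : Set (List L) :=
  A.tracesFrom A.init

end LTS

/-! ### Memory actions, memory events, memory models -/

inductive MemAction (Var Val : Type u) : Type u
  | write (x : Var) (v : Val)
  | read (x : Var) (v : Val)
  | rmw (x : Var) (vold vnew : Val)
  | fence

inductive MemType : Type
  | W | R | RMW | F

namespace MemAction

variable {Var Val : Type u}

def type : MemAction Var Val → MemType
  | write _ _ => .W
  | read _ _ => .R
  | rmw _ _ _ => .RMW
  | fence => .F

/-- The variable accessed by an action (`none` for a fence). -/
def var : MemAction Var Val → Option Var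
  | write x _ => some x
  | read x _ => some x
  | rmw x _ _ => some x
  | fence => none

end MemAction

structure MemEvent (P Var Val : Type u) : Type u where
  proc : P
  action : MemAction Var Val

namespace MemEvent

variable {P Var Val : Type u}

def type (e : MemEvent P Var Val) : MemType := e.action.type

def var (e : MemEvent P Var Val) : Option Var := e.action.var

end MemEvent

/-- A memory model is an LTS whose labels are the memory events (`some e`)
and the silent step `τ` (`none`). -/
abbrev MemoryModel (P Var Val : Type u) : Type (u + 1) :=
  LTS.{u, u} (Option (MemEvent P Var Val))

/-- Observable traces of a memory model: its traces with the silent steps removed. -/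
def MemoryModel.otraces {P Var Val : Type u} (M : MemoryModel P Var Val) :
    Set (List (MemEvent P Var Val)) :=
  {σ | ∃ ρ ∈ LTS.traces M, ρ.reduceOption = σ}

section Models

variable {P Var Val : Type u}

/-! #### Strongly consistent memory -/

inductive SCMStep [DecidableEq Var] :
    (Var → Val) → Option (MemEvent P Var Val) → (Var → Val) → Prop
  | write (m : Var → Val) (p : P) (x : Var) (v : Val) :
      SCMStep m (some ⟨p, .write x v⟩) (Function.update m x v)
  | read (m : Var → Val) (p : P) (x : Var) :
      SCMStep m (some ⟨p, .read x (m x)⟩) m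
  | rmw (m : Var → Val) (p : P) (x : Var) (vold vnew : Val) (h : m x = vold) :
      SCMStep m (some ⟨p, .rmw x vold vnew⟩) (Function.update m x vnew)
  | fence (m : Var → Val) (p : P) :
      SCMStep m (some ⟨p, .fence⟩) m

def SCM (P Var Val : Type u) [DecidableEq Var] [Zero Val] : MemoryModel P Var Val where
  State := Var → Val
  init := fun _ => 0
  Trans := SCMStep

/-! #### Total store order -/

/-- A main memory, and a first-in first-out store buffer for every process (oldest entry first). -/
structure TSOState (P Var Val : Type u) : Type u where
  mem : Var → Val
  buf : P → List (Var × Val)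

inductive TSOStep [DecidableEq P] [DecidableEq Var] :
    TSOState P Var Val → Option (MemEvent P Var Val) → TSOState P Var Val → Prop
  | write (m : Var → Val) (b : P → List (Var × Val)) (p : P) (x : Var) (v : Val) :
      TSOStep ⟨m, b⟩ (some ⟨p, .write x v⟩) ⟨m, Function.update b p (b p ++ [(x, v)])⟩
  | readFromBuffer (m : Var → Val) (b : P → List (Var × Val)) (p : P) (x : Var) (v : Val)
      (h : ((b p).filter (fun w => w.1 = x)).getLast? = some (x, v)) :
      TSOStep ⟨m, b⟩ (some ⟨p, .read x v⟩) ⟨m, b⟩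
  | readFromMemory (m : Var → Val) (b : P → List (Var × Val)) (p : P) (x : Var) (v : Val)
      (hb : (b p).filter (fun w => w.1 = x) = []) (hm : m x = v) :
      TSOStep ⟨m, b⟩ (some ⟨p, .read x v⟩) ⟨m, b⟩
  | rmw (m : Var → Val) (b : P → List (Var × Val)) (p : P) (x : Var) (vold vnew : Val)
      (hb : b p = []) (hm : m x = vold) :
      TSOStep ⟨m, b⟩ (some ⟨p, .rmw x vold vnew⟩) ⟨Function.update m x vnew, b⟩
  | fence (m : Var → Val) (b : P → List (Var × Val)) (p : P) (hb : b p = []) :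
      TSOStep ⟨m, b⟩ (some ⟨p, .fence⟩) ⟨m, b⟩
  | propagate (m : Var → Val) (b : P → List (Var × Val)) (p : P) (x : Var) (v : Val)
      (β : List (Var × Val)) (hb : b p = (x, v) :: β) :
      TSOStep ⟨m, b⟩ none ⟨Function.update m x v, Function.update b p β⟩

def TSO (P Var Val : Type u) [DecidableEq P] [DecidableEq Var] [Zero Val] :
    MemoryModel P Var Val where
  State := TSOState P Var Val
  init := ⟨fun _ => 0, fun _ => []⟩
  Trans := TSOStep

/-! #### Release-acquire -/

/-- A message: variable, value, timestamp, view. -/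
structure RAMessage (Var Val : Type u) : Type u where
  var : Var
  val : Val
  time : ℕ
  view : Var → ℕ

/-- The set of messages, the view of every process, and the fence view. -/
structure RAState (P Var Val : Type u) : Type u where
  msgs : Set (RAMessage Var Val)
  pview : P → Var → ℕ
  fview : Var → ℕ

/-- The join `⊔` of two views is the pointwise maximum. -/
inductive RAStep [DecidableEq P] [DecidableEq Var] :
    RAState P Var Val → Option (MemEvent P Var Val) → RAState P Var Val → Prop
  | write (m : Set (RAMessage Var Val)) (V : P → Var → ℕ) (F : Var → ℕ)
      (p : P) (x : Var) (v : Val) (t : ℕ)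
      (hlt : V p x < t) (hfresh : ∀ μ ∈ m, μ.var = x → μ.time ≠ t) :
      RAStep ⟨m, V, F⟩ (some ⟨p, .write x v⟩)
        ⟨m ∪ {⟨x, v, t, Function.update (V p) x t⟩},
          Function.update V p (Function.update (V p) x t), F⟩
  | read (m : Set (RAMessage Var Val)) (V : P → Var → ℕ) (F : Var → ℕ)
      (p : P) (x : Var) (v : Val) (U : Var → ℕ)
      (hmem : (⟨x, v, V p x, U⟩ : RAMessage Var Val) ∈ m) :
      RAStep ⟨m, V, F⟩ (some ⟨p, .read x v⟩) ⟨m, V, F⟩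
  | fence (m : Set (RAMessage Var Val)) (V : P → Var → ℕ) (F : Var → ℕ) (p : P) :
      RAStep ⟨m, V, F⟩ (some ⟨p, .fence⟩) ⟨m, Function.update V p (V p ⊔ F), V p ⊔ F⟩
  | rmw (m : Set (RAMessage Var Val)) (V : P → Var → ℕ) (F : Var → ℕ)
      (p : P) (x : Var) (vold vnew : Val) (U : Var → ℕ)
      (hmem : (⟨x, vold, V p x, U⟩ : RAMessage Var Val) ∈ m)
      (hfresh : ∀ μ ∈ m, μ.var = x → μ.time ≠ V p x + 1) :
      RAStep ⟨m, V, F⟩ (some ⟨p, .rmw x vold vnew⟩)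
        ⟨m ∪ {⟨x, vnew, V p x + 1, Function.update (V p) x (V p x + 1)⟩},
          Function.update V p (Function.update (V p) x (V p x + 1)), F⟩
  | propagate (m : Set (RAMessage Var Val)) (V : P → Var → ℕ) (F : Var → ℕ)
      (p : P) (μ : RAMessage Var Val) (hmem : μ ∈ m) (hlt : V p μ.var < μ.time) :
      RAStep ⟨m, V, F⟩ none ⟨m, Function.update V p (V p ⊔ μ.view), F⟩

def RA (P Var Val : Type u) [DecidableEq P] [DecidableEq Var] [Zero Val] :
    MemoryModel P Var Val where
  State := RAState P Var Val
  init := ⟨{μ | ∃ x : Var, μ = ⟨x, 0, 0, fun _ => 0⟩}, fun _ _ => 0, fun _ => 0⟩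
  Trans := RAStep

end Models

/-! ### Patterns of observable memory sequences -/

section Patterns

variable {P Var Val : Type u}

def HasRMW (σ : List (MemEvent P Var Val)) : Prop :=
  ∃ e ∈ σ, e.type = .RMW

/-- Read-before-write: between a write and a later read of a different variable
there is a write to the variable that is read. -/
def IsRBW (σ : List (MemEvent P Var Val)) : Prop :=
  ∀ k₁ k₂ : Fin σ.length, k₁ < k₂ →
    (σ.get k₁).type = .W → (σ.get k₂).type = .R → (σ.get k₁).var ≠ (σ.get k₂).var →
    ∃ k : Fin σ.length, k₁ < k ∧ k < k₂ ∧
      (σ.get k).type = .W ∧ (σ.get k).var = (σ.get k₂).var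

/-- Trailing-fence: no fence is immediately followed by a non-fence event. -/
def IsTF (σ : List (MemEvent P Var Val)) : Prop :=
  ¬ ∃ (k : ℕ) (e e' : MemEvent P Var Val),
    σ[k]? = some e ∧ σ[k + 1]? = some e' ∧ e.type = .F ∧ e'.type ≠ .F

/-- Leading-fence: no fence is immediately preceded by a non-fence event. -/
def IsLF (σ : List (MemEvent P Var Val)) : Prop :=
  ¬ ∃ (k : ℕ) (e e' : MemEvent P Var Val),
    σ[k]? = some e' ∧ σ[k + 1]? = some e ∧ e.type = .F ∧ e'.type ≠ .F

/-- Leading-and-trailing-fence. -/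
def IsLTF (σ : List (MemEvent P Var Val)) : Prop :=
  ∃ σ₁ σ₂ : List (MemEvent P Var Val), σ = σ₁ ++ σ₂ ∧ IsLF σ₁ ∧ IsTF σ₂

end Patterns

/-! ### Histories and objects -/

inductive ObjAction (Op : Type v) (Ret : Type w) : Type (max v w)
  | inv (o : Op)
  | res (r : Ret)

structure ObjEvent (P : Type u) (Op : Type v) (Ret : Type w) : Type (max u v w) where
  proc : P
  action : ObjAction Op Ret

section Histories

variable {P : Type u} {Op : Type v} {Ret : Type w}

def ObjEvent.IsInv (e : ObjEvent P Op Ret) : Prop := ∃ o, e.action = .inv o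

def ObjEvent.IsRes (e : ObjEvent P Op Ret) : Prop := ∃ r, e.action = .res r

/-- A single operation by `p` that invokes `o` and gets the response `r`. -/
def invRes (p : P) (o : Op) (r : Ret) : List (ObjEvent P Op Ret) :=
  [⟨p, .inv o⟩, ⟨p, .res r⟩]

/-- A prefix of a concatenation of single operations. -/
def IsSequential (h : List (ObjEvent P Op Ret)) : Prop :=
  ∃ l : List (P × Op × Ret), h <+: l.flatMap (fun a => invRes a.1 a.2.1 a.2.2)

/-- The restriction of a history to the events of process `p`. -/
def restrictProc [DecidableEq P] (h : List (ObjEvent P Op Ret)) (p : P) :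
    List (ObjEvent P Op Ret) :=
  h.filter (fun e => e.proc = p)

def IsWellFormed [DecidableEq P] (h : List (ObjEvent P Op Ret)) : Prop :=
  ∀ p, IsSequential (restrictProc h p)

/-- Well-formed, and the events of each process that occurs in `h` end with a response. -/
def IsCompleteHist [DecidableEq P] (h : List (ObjEvent P Op Ret)) : Prop :=
  IsWellFormed h ∧ ∀ p, ∀ e, (restrictProc h p).getLast? = some e → e.IsRes

/-- Complete sequential histories. -/
def IsCSH [DecidableEq P] (h : List (ObjEvent P Op Ret)) : Prop :=
  IsCompleteHist h ∧ IsSequential h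

/-- `s'` is an `R`-reordering of `s`. -/
def IsReordering {X : Type u} (R : X → X → Prop) (s s' : List X) : Prop :=
  ∃ f : Fin s.length ≃ Fin s'.length,
    (∀ i, s.get i = s'.get (f i)) ∧
    ∀ i j, i < j → R (s.get i) (s.get j) → f i < f j

def linRel (e₁ e₂ : ObjEvent P Op Ret) : Prop :=
  e₁.proc = e₂.proc ∨ (e₁.IsRes ∧ e₂.IsInv)

/-- `h'` linearizes `h` (for well-formed histories `h` and `h'`). -/
def Linearizes (h h' : List (ObjEvent P Op Ret)) : Prop :=
  IsReordering linRel h h'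

/-- An object with operation names `Op` and response values `Ret` is given by its specification,
a set of complete sequential histories that is closed under complete sequential prefixes. -/
structure ConcObject (P : Type u) [DecidableEq P] (Op : Type v) (Ret : Type w) where
  spec : Set (List (ObjEvent P Op Ret))
  isCSH_of_mem : ∀ h ∈ spec, IsCSH h
  prefix_closed : ∀ h ∈ spec, ∀ h', IsCSH h' → h' <+: h → h' ∈ spec

/-- `c` is the longest common prefix of `h` and `h'`. -/
def IsLongestCommonPrefix {X : Type u} (c h h' : List X) : Prop :=
  c <+: h ∧ c <+: h' ∧ ∀ d, d <+: h → d <+: h' → d <+: c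

/-- No two histories in the specification have a longest common prefix
that ends with an invocation. -/
def ConcObject.Deterministic [DecidableEq P] (O : ConcObject P Op Ret) : Prop :=
  ¬ ∃ h ∈ O.spec, ∃ h' ∈ O.spec, ∃ c e,
    IsLongestCommonPrefix c h h' ∧ c.getLast? = some e ∧ e.IsInv

def ConcObject.TwoSidedNonCommutative [DecidableEq P] (O : ConcObject P Op Ret)
    (o₁ o₂ : Op) : Prop :=
  ∃ (h₀ : List (ObjEvent P Op Ret)) (p₁ p₂ : P) (u₁ v₁ u₂ v₂ : Ret),
    IsCSH h₀ ∧ p₁ ≠ p₂ ∧ u₁ ≠ v₁ ∧ u₂ ≠ v₂ ∧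
    h₀ ++ invRes p₁ o₁ u₁ ++ invRes p₂ o₂ v₂ ∈ O.spec ∧
    h₀ ++ invRes p₂ o₂ u₂ ++ invRes p₁ o₁ v₁ ∈ O.spec

end Histories

/-! ### Implementations -/

/-- An event is a memory event or an object event. -/
inductive Event (P Var Val : Type u) (Op : Type v) (Ret : Type w) : Type (max u v w)
  | mem (e : MemEvent P Var Val)
  | obj (e : ObjEvent P Op Ret)

section Implementations

variable {P Var Val : Type u} {Op : Type v} {Ret : Type w}

namespace Event

def proc : Event P Var Val Op Ret → P
  | mem e => e.proc
  | obj e => e.proc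

def mem? : Event P Var Val Op Ret → Option (MemEvent P Var Val)
  | mem e => some e
  | obj _ => none

def obj? : Event P Var Val Op Ret → Option (ObjEvent P Op Ret)
  | mem _ => none
  | obj e => some e

end Event

/-- The restriction of a sequence of events to the memory events. -/
def restrictMem (π : List (Event P Var Val Op Ret)) : List (MemEvent P Var Val) :=
  π.filterMap Event.mem?

/-- The restriction of a sequence of events to the object events. -/
def restrictObj (π : List (Event P Var Val Op Ret)) : List (ObjEvent P Op Ret) :=
  π.filterMap Event.obj?

/-- An implementation of an operation for the process `p`: an LTS labelled by events of `p`
in which no transition is enabled after a response. -/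
structure OpImpl (P Var Val : Type u) (Op : Type v) (Ret : Type w) (p : P) extends
    LTS.{max u v w, z} (Event P Var Val Op Ret) where
  proc_eq : ∀ q e q', Trans q e q' → e.proc = p
  res_last : ∀ q r q', Trans q (.obj ⟨p, .res r⟩) q' → ∀ e q'', ¬ Trans q' e q''

/-- An implementation of an object: an implementation of each operation for each process. -/
abbrev Implementation (P Var Val : Type u) (Op : Type v) (Ret : Type w) :=
  Op → (p : P) → OpImpl.{u, v, w, z} P Var Val Op Ret p

namespace Implementation

variable (I : Implementation.{u, v, w, z} P Var Val Op Ret)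

/-- `none`: process `p` executes no operation; `some ⟨o, q⟩`: it executes `o` and is in state `q`
of the implementation of `o`. -/
inductive ProcStep (p : P) :
    Option (Σ o : Op, (I o p).State) → Event P Var Val Op Ret →
      Option (Σ o : Op, (I o p).State) → Prop
  | invoke (o : Op) :
      ProcStep p none (.obj ⟨p, .inv o⟩) (some ⟨o, (I o p).init⟩)
  | memory (o : Op) (q q' : (I o p).State) (e : MemEvent P Var Val)
      (h : (I o p).Trans q (.mem e) q') :
      ProcStep p (some ⟨o, q⟩) (.mem e) (some ⟨o, q'⟩)
  | respond (o : Op) (q q' : (I o p).State) (r : Ret)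
      (h : (I o p).Trans q (.obj ⟨p, .res r⟩) q') :
      ProcStep p (some ⟨o, q⟩) (.obj ⟨p, .res r⟩) none

/-- The system induced by an implementation: the processes repeatedly and concurrently
execute operations, and their steps are interleaved. -/
def sys [DecidableEq P] : LTS (Event P Var Val Op Ret) where
  State := (p : P) → Option (Σ o : Op, (I o p).State)
  init := fun _ => none
  Trans := fun q e q' => ∃ p r, I.ProcStep p (q p) e r ∧ q' = Function.update q p r

/-- Histories generated by the implementation after `π₀` under the memory model `M`. -/
def historiesAfter [DecidableEq P] (π₀ : List (Event P Var Val Op Ret))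
    (M : MemoryModel P Var Val) : Set (List (ObjEvent P Op Ret)) :=
  {h | ∃ π, π₀ ++ π ∈ I.sys.traces ∧ restrictMem (π₀ ++ π) ∈ M.otraces ∧ restrictObj π = h}

/-- Every complete history generated under `M` is linearized by a history of the specification. -/
def Consistent [DecidableEq P] (O : ConcObject P Op Ret) (M : MemoryModel P Var Val) : Prop :=
  ∀ h ∈ I.historiesAfter [] M, IsCompleteHist h → ∃ h' ∈ O.spec, Linearizes h h'

/-- Availability after `h₀` with respect to `h`. -/
def AvailableAfter [DecidableEq P] [DecidableEq Var] [Zero Val]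
    (h₀ h : List (ObjEvent P Op Ret)) : Prop :=
  ∀ π₀ ∈ I.sys.traces, restrictMem π₀ ∈ (SCM P Var Val).otraces → restrictObj π₀ = h₀ →
    h ∈ I.historiesAfter π₀ (SCM P Var Val)

def SpecAvailable [DecidableEq P] [DecidableEq Var] [Zero Val]
    (O : ConcObject P Op Ret) : Prop :=
  ∀ h₀ h, IsCSH h₀ → IsCSH h → h₀ ++ h ∈ O.spec → I.AvailableAfter h₀ h

end Implementation

end Implementations

/-! ### Runs of labelled transition systems and memory models -/

/-! By spec-availability, `h₀` is produced by an execution `π₀` under SCM. After `π₀`, `p₁` can run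
`o₁` alone with response `u₁` and memory trace `σ₁`; alternatively `p₂` can run `o₂` alone with
response `u₂` and memory trace `σ₂`. Both traces start from the memory that `π₀` leaves.

Suppose that `σ₁` has no RMW and has the pattern in question. Then `σ₁ = α ++ β` such that the
memory trace of `π₀` followed by `α ++ σ₂ ++ β` is an observable trace of `M`: neither operation
notices the other. So `M` also allows `o₂` to be nested inside `o₁`, with responses `u₂` and `u₁`
(`Implementation.exists_sysRun_nested`). By consistency this history has a linearization, which is
`h₀` followed by the two operations in one of the two orders (`Linearizes.overlapping`). By
determinism the second operation must return what non-commutativity prescribes (`res_unique`), so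
`u₂ = v₂` or `u₁ = v₁`, a contradiction.

The split of `σ₁` depends on the model. SCM (`SCMRun.merge`): `σ₂` goes right before the first
write. Until then `σ₁` has changed nothing, and by RBW every later read concerns a variable that
`σ₁` has itself written since. TSO (`TSO_merge`): `σ₂` goes before the trailing fences. Until then
the writes of `σ₁` wait in the store buffer of `p₁`. RA (`RA_merge`): the split is the same. The
writes of `σ₁` receive timestamps so large that all writes of `σ₂` fit below them, and the other
processes never learn of these messages. -/

theorem LTS.run_append {L : Type u} {A : LTS.{u, v} L} {q q' : A.State} {π₁ π₂ : List L} :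
    A.Run q (π₁ ++ π₂) q' ↔ ∃ r, A.Run q π₁ r ∧ A.Run r π₂ q' := by
  induction π₁ generalizing q with
  | nil => simp [LTS.Run]
  | cons l π ih =>
    simp only [List.cons_append, LTS.Run, ih]
    constructor
    · rintro ⟨r, h, s, h₁, h₂⟩
      exact ⟨s, ⟨r, h, h₁⟩, h₂⟩
    · rintro ⟨s, ⟨r, h, h₁⟩, h₂⟩
      exact ⟨r, h, s, h₁, h₂⟩

theorem LTS.run_singleton {L : Type u} {A : LTS.{u, v} L} {q q' : A.State} {l : L} :
    A.Run q [l] q' ↔ A.Trans q l q' := by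
  simp [LTS.Run]

section Memory

variable {P Var Val : Type u}

/-- Some execution fragment from `q` to `q'` has the observable trace `σ`. -/
def MemoryModel.ORun (M : MemoryModel P Var Val) (q : M.State) (σ : List (MemEvent P Var Val))
    (q' : M.State) : Prop :=
  ∃ ρ, LTS.Run M q ρ q' ∧ ρ.reduceOption = σ

namespace MemoryModel

variable {M : MemoryModel P Var Val} {q q' q'' : M.State} {σ σ' : List (MemEvent P Var Val)}

theorem mem_otraces_iff : σ ∈ M.otraces ↔ ∃ q, M.ORun M.init σ q := by
  constructor
  · rintro ⟨ρ, ⟨q, h⟩, hρ⟩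
    exact ⟨q, ρ, h, hρ⟩
  · rintro ⟨q, ρ, h, hρ⟩
    exact ⟨ρ, ⟨q, h⟩, hρ⟩

theorem ORun.refl (q : M.State) : M.ORun q [] q := ⟨[], rfl, rfl⟩

theorem ORun.append (h : M.ORun q σ q') (h' : M.ORun q' σ' q'') : M.ORun q (σ ++ σ') q'' := by
  obtain ⟨ρ, h, rfl⟩ := h
  obtain ⟨ρ', h', rfl⟩ := h'
  exact ⟨ρ ++ ρ', LTS.run_append.2 ⟨_, h, h'⟩, List.reduceOption_append _ _⟩

theorem ORun.cons {e : MemEvent P Var Val} (h : M.Trans q (some e) q') (h' : M.ORun q' σ q'') :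
    M.ORun q (e :: σ) q'' := by
  obtain ⟨ρ, h', rfl⟩ := h'
  exact ⟨some e :: ρ, ⟨_, h, h'⟩, List.reduceOption_cons_of_some _ _⟩

theorem ORun.silent (h : M.Trans q none q') (h' : M.ORun q' σ q'') : M.ORun q σ q'' := by
  obtain ⟨ρ, h', rfl⟩ := h'
  exact ⟨none :: ρ, ⟨_, h, h'⟩, List.reduceOption_cons_of_none _⟩

end MemoryModel

/-! ### Strongly consistent memory -/

theorem exists_split_first_write (σ : List (MemEvent P Var Val)) :
    (∀ e ∈ σ, e.type ≠ .W) ∨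
      ∃ s e t, σ = s ++ e :: t ∧ (∀ e ∈ s, e.type ≠ .W) ∧ e.type = .W := by
  induction σ with
  | nil => simp
  | cons e σ ih =>
    by_cases he : e.type = .W
    · exact .inr ⟨[], e, σ, rfl, by simp, he⟩
    · rcases ih with h | ⟨s, e', t, rfl, h, h'⟩
      · exact .inl (by simpa [he] using h)
      · exact .inr ⟨e :: s, e', t, rfl, by simpa [he] using h, h'⟩

theorem MemEvent.type_eq_write_iff {e : MemEvent P Var Val} {x : Var} :
    e.type = .W ∧ e.var = some x ↔ ∃ p v, e = ⟨p, .write x v⟩ := by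
  obtain ⟨p, a⟩ := e
  cases a <;> simp [MemEvent.type, MemEvent.var, MemAction.type, MemAction.var]

section SCM

variable [DecidableEq Var]

/-- Runs of strongly consistent memory, independent of the initial state. -/
inductive SCMRun : (Var → Val) → List (MemEvent P Var Val) → (Var → Val) → Prop
  | nil (m : Var → Val) : SCMRun m [] m
  | cons {m m' m'' : Var → Val} {e : MemEvent P Var Val} {σ : List (MemEvent P Var Val)}
      (h : SCMStep m (some e) m') (h' : SCMRun m' σ m'') : SCMRun m (e :: σ) m''

theorem SCM_orun_iff [Zero Val] {m m' : Var → Val} {σ : List (MemEvent P Var Val)} :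
    (SCM P Var Val).ORun m σ m' ↔ SCMRun m σ m' := by
  constructor
  · rintro ⟨ρ, h, rfl⟩
    induction ρ generalizing m with
    | nil => cases h; exact .nil _
    | cons l ρ ih =>
      obtain ⟨r, h, h'⟩ := h
      cases l with
      | none => cases h
      | some e =>
        rw [List.reduceOption_cons_of_some]
        exact .cons h (ih h')
  · intro h
    induction h with
    | nil => exact .refl (M := SCM P Var Val) _
    | cons h _ ih => exact .cons (M := SCM P Var Val) h ih

theorem SCMRun.append_iff {m m' : Var → Val} {σ σ' : List (MemEvent P Var Val)} :
    SCMRun m (σ ++ σ') m' ↔ ∃ r, SCMRun m σ r ∧ SCMRun r σ' m' := by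
  induction σ generalizing m with
  | nil =>
    constructor
    · intro h
      exact ⟨m, .nil m, h⟩
    · rintro ⟨r, h, h'⟩
      cases h
      exact h'
  | cons e σ ih =>
    constructor
    · rintro (_ | ⟨h, h'⟩)
      obtain ⟨r, h₁, h₂⟩ := ih.1 h'
      exact ⟨r, .cons h h₁, h₂⟩
    · rintro ⟨r, _ | ⟨h, h₁⟩, h₂⟩
      exact .cons h (ih.2 ⟨r, h₁, h₂⟩)

theorem SCMStep.unique {m m' m'' : Var → Val} {e : MemEvent P Var Val}
    (h : SCMStep m (some e) m') (h' : SCMStep m (some e) m'') : m' = m'' := by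
  cases h <;> cases h' <;> rfl

/-- The two operations come from separate extensions of one execution; since the events determine
the memory, both start from the same one. -/
theorem SCMRun.unique {m m' m'' : Var → Val} {σ : List (MemEvent P Var Val)}
    (h : SCMRun m σ m') (h' : SCMRun m σ m'') : m' = m'' := by
  induction h with
  | nil => cases h'; rfl
  | cons h _ ih =>
    cases h' with
    | cons g g' =>
      cases h.unique g
      exact ih g'

theorem SCMRun.eq_of_no_write {m m' : Var → Val} {σ : List (MemEvent P Var Val)}
    (h : SCMRun m σ m') (hσ : ∀ e ∈ σ, e.type ≠ .W ∧ e.type ≠ .RMW) : m' = m := by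
  induction h with
  | nil => rfl
  | cons h _ ih =>
    have h₁ := hσ _ List.mem_cons_self
    rw [ih fun e he => hσ e (List.mem_cons_of_mem _ he)]
    cases h <;> first | rfl | exact absurd rfl h₁.1 | exact absurd rfl h₁.2

/-- A run whose reads are preceded by its own writes can start from any memory. -/
theorem SCMRun.transfer {m m' : Var → Val} {σ : List (MemEvent P Var Val)}
    (h : SCMRun m σ m') (hσ : ∀ e ∈ σ, e.type ≠ .RMW) (n : Var → Val)
    (hr : ∀ s t p x v, σ = s ++ ⟨p, .read x v⟩ :: t →
      m x = n x ∨ ∃ q w, (⟨q, .write x w⟩ : MemEvent P Var Val) ∈ s) :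
    ∃ n', SCMRun n σ n' := by
  induction h generalizing n with
  | nil => exact ⟨n, .nil n⟩
  | @cons m m₁ m₂ e σ h _ ih =>
    have hσ' : ∀ e ∈ σ, e.type ≠ .RMW := fun e he => hσ e (List.mem_cons_of_mem _ he)
    cases h with
    | write p x v =>
      -- After the write both memories agree at `x`, so this write may disappear from the list of
      -- earlier events.
      obtain ⟨n', hn⟩ := ih hσ' (Function.update n x v) (by
        intro s t p' y v' hs
        by_cases hyx : y = x
        · subst hyx
          simp
        · rcases hr (⟨p, .write x v⟩ :: s) t p' y v' (by simp [hs]) with h | ⟨q, w, h⟩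
          · simp [Function.update_of_ne hyx, h]
          · rcases List.mem_cons.1 h with h | h
            · simp only [MemEvent.mk.injEq, MemAction.write.injEq] at h
              exact absurd h.2.1 hyx
            · exact .inr ⟨q, w, h⟩)
      exact ⟨n', .cons (.write n p x v) hn⟩
    | read p x =>
      have hx : m x = n x := by
        rcases hr [] σ p x (m x) rfl with h | ⟨_, _, h⟩
        · exact h
        · simp at h
      obtain ⟨n', hn⟩ := ih hσ' n (by
        intro s t p' y v' hs
        rcases hr (⟨p, .read x (m x)⟩ :: s) t p' y v' (by simp [hs]) with h | ⟨q, w, h⟩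
        · exact .inl h
        · exact .inr ⟨q, w, by simpa using h⟩)
      rw [hx]
      exact ⟨n', .cons (.read n p x) hn⟩
    | rmw => exact absurd rfl (hσ _ List.mem_cons_self)
    | fence p =>
      obtain ⟨n', hn⟩ := ih hσ' n (by
        intro s t p' y v' hs
        rcases hr (⟨p, .fence⟩ :: s) t p' y v' (by simp [hs]) with h | ⟨q, w, h⟩
        · exact .inl h
        · exact .inr ⟨q, w, by simpa using h⟩)
      exact ⟨n', .cons (.fence n p) hn⟩

/-- Under strongly consistent memory, a whole run `τ` can be scheduled right before
the first write of a read-before-write run. -/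
theorem SCMRun.merge {m m₁ m₂ : Var → Val} {σ τ : List (MemEvent P Var Val)}
    (hσ : SCMRun m σ m₁) (hτ : SCMRun m τ m₂) (hrmw : ¬ HasRMW σ) (hrbw : IsRBW σ) :
    ∃ α β m', σ = α ++ β ∧ SCMRun m (α ++ τ ++ β) m' := by
  have hno : ∀ e ∈ σ, e.type ≠ .RMW := fun e he h => hrmw ⟨e, he, h⟩
  rcases exists_split_first_write σ with h | ⟨s, e, t, rfl, hs, he⟩
  -- Without writes, `σ` leaves the memory unchanged and `τ` can run after all of it.
  · have := hσ.eq_of_no_write fun e he => ⟨h e he, hno e he⟩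
    subst this
    exact ⟨σ, [], m₂, by simp, by simpa using SCMRun.append_iff.2 ⟨_, hσ, hτ⟩⟩
  · obtain ⟨r, h₁, h₂⟩ := SCMRun.append_iff.1 hσ
    have := h₁.eq_of_no_write fun e he => ⟨hs e he, hno e (by simp [he])⟩
    subst this
    -- `τ` may have changed any variable, so each read of `e :: t` has to be justified by an earlier
    -- write in `e :: t`.
    obtain ⟨m', h'⟩ := h₂.transfer (fun e' he' => hno e' (List.mem_append_right _ he')) m₂ (by
      intro a b p x v hab
      right
      cases a with
      | nil =>
        simp only [List.nil_append, List.cons.injEq] at hab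
        rw [hab.1] at he
        cases he
      | cons e' a =>
        simp only [List.cons_append, List.cons.injEq] at hab
        obtain ⟨rfl, rfl⟩ := hab
        by_cases hx : e.var = some x
        · obtain ⟨q, w, rfl⟩ := MemEvent.type_eq_write_iff.1 ⟨he, hx⟩
          exact ⟨q, w, by simp⟩
        -- RBW is applied to the first write, at position `s.length`, and the read, which follows it
        -- after the events of `a`. The write in between is therefore an element of `a`.
        · obtain ⟨⟨k, hk⟩, hk₁, hk₂, hk₃, hk₄⟩ := hrbw ⟨s.length, by simp⟩
            ⟨s.length + 1 + a.length, by simp; omega⟩ (by simp [Fin.lt_def]; omega)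
            (by simpa using he)
            (by
              simp only [List.get_eq_getElem]
              rw [List.getElem_append_right (by omega)]
              simp [Nat.add_assoc, Nat.add_comm 1, MemEvent.type, MemAction.type])
            (by
              simp only [List.get_eq_getElem]
              rw [List.getElem_append_right (by omega), List.getElem_append_right (by omega)]
              simpa [Nat.add_assoc, Nat.add_comm 1, MemEvent.var, MemAction.var] using hx)
          simp only [Fin.lt_def] at hk₁ hk₂
          have hvar : ((s ++ e :: (a ++ ⟨p, .read x v⟩ :: b)).get ⟨k, hk⟩).var = some x := by
            rw [hk₄]
            simp only [List.get_eq_getElem]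
            rw [List.getElem_append_right (by omega)]
            simp [Nat.add_assoc, Nat.add_comm 1, MemEvent.var, MemAction.var]
          obtain ⟨q, w, hqw⟩ := MemEvent.type_eq_write_iff.1 ⟨hk₃, hvar⟩
          refine ⟨q, w, List.mem_cons_of_mem _ ?_⟩
          rw [← hqw]
          simp only [List.get_eq_getElem]
          obtain ⟨d, rfl⟩ : ∃ d, k = s.length + (d + 1) := ⟨k - s.length - 1, by omega⟩
          rw [List.getElem_append_right (by omega)]
          simp only [Nat.add_sub_cancel_left, List.getElem_cons_succ]
          rw [List.getElem_append_left (by omega)]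
          exact List.getElem_mem _)
    exact ⟨s, e :: t, m', rfl, SCMRun.append_iff.2 ⟨_, SCMRun.append_iff.2 ⟨_, h₁, hτ⟩, h'⟩⟩

end SCM

/-! ### Fences at both ends -/

theorem IsLF.exists_split {σ : List (MemEvent P Var Val)} (h : IsLF σ) :
    ∃ a b, σ = a ++ b ∧ (∀ e ∈ a, e.type = .F) ∧ ∀ e ∈ b, e.type ≠ .F := by
  induction σ with
  | nil => exact ⟨[], [], rfl, by simp, by simp⟩
  | cons e σ ih =>
    obtain ⟨a, b, rfl, ha, hb⟩ := ih fun ⟨k, f, f', h₁, h₂, h₃, h₄⟩ =>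
      h ⟨k + 1, f, f', by simpa using h₁, by simpa using h₂, h₃, h₄⟩
    by_cases he : e.type = .F
    · exact ⟨e :: a, b, rfl, by simpa [he] using ha, hb⟩
    · cases a with
      | nil => exact ⟨[], e :: b, rfl, by simp, by simpa [he] using hb⟩
      | cons f a => exact absurd ⟨0, f, e, by simp, by simp, ha f (by simp), he⟩ h

theorem IsTF.exists_split {σ : List (MemEvent P Var Val)} (h : IsTF σ) :
    ∃ b c, σ = b ++ c ∧ (∀ e ∈ b, e.type ≠ .F) ∧ ∀ e ∈ c, e.type = .F := by
  induction σ with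
  | nil => exact ⟨[], [], rfl, by simp, by simp⟩
  | cons e σ ih =>
    obtain ⟨b, c, rfl, hb, hc⟩ := ih fun ⟨k, f, f', h₁, h₂, h₃, h₄⟩ =>
      h ⟨k + 1, f, f', by simpa using h₁, by simpa using h₂, h₃, h₄⟩
    by_cases he : e.type = .F
    · cases b with
      | nil => exact ⟨[], e :: c, rfl, by simp, by simpa [he] using hc⟩
      | cons f b => exact absurd ⟨0, e, f, by simp, by simp, he, hb f (by simp)⟩ h
    · exact ⟨e :: b, c, rfl, by simpa [he] using hb, hc⟩

/-- The fence-free end of the LF part and the fence-free start of the TF part are adjacent and form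
one block. -/
theorem IsLTF.exists_split {σ : List (MemEvent P Var Val)} (h : IsLTF σ) :
    ∃ a b c, σ = a ++ b ++ c ∧ (∀ e ∈ a, e.type = .F) ∧ (∀ e ∈ b, e.type ≠ .F) ∧
      ∀ e ∈ c, e.type = .F := by
  obtain ⟨σ₁, σ₂, rfl, h₁, h₂⟩ := h
  obtain ⟨a, b, rfl, ha, hb⟩ := h₁.exists_split
  obtain ⟨b', c, rfl, hb', hc⟩ := h₂.exists_split
  refine ⟨a, b ++ b', c, by simp, ha, fun e he => ?_, hc⟩
  exact (List.mem_append.1 he).elim (hb e) (hb' e)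

theorem MemEvent.eq_fence_of_type {e : MemEvent P Var Val} (h : e.type = .F) :
    e = ⟨e.proc, .fence⟩ := by
  obtain ⟨p, a⟩ := e
  cases a <;> first | rfl | cases h

/-! ### Total store order -/

section TSO

variable [DecidableEq P] [DecidableEq Var]

/-- With empty buffers, total store order simulates strongly consistent memory. -/
theorem TSO_orun_of_SCMRun [Zero Val] {m m' : Var → Val} {σ : List (MemEvent P Var Val)}
    (h : SCMRun m σ m') (b : P → List (Var × Val)) (hb : ∀ e ∈ σ, b e.proc = []) :
    (TSO P Var Val).ORun ⟨m, b⟩ σ ⟨m', b⟩ := by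
  induction h with
  | nil => exact .refl (M := TSO P Var Val) _
  | @cons m m₁ m₂ e σ h _ ih =>
    have hb₁ : b e.proc = [] := hb e List.mem_cons_self
    have ih := ih fun e he => hb e (List.mem_cons_of_mem _ he)
    cases h with
    | write p x v =>
      -- Each write is propagated at once, which empties the buffer again. Buffers of processes
      -- outside `σ` may hold pending writes throughout.
      refine .cons (M := TSO P Var Val) (.write m b p x v) (.silent (M := TSO P Var Val)
        (.propagate m _ p x v [] ?_) ?_)
      · simp only at hb₁
        simp [hb₁]
      · simp only at hb₁
        rw [Function.update_idem, ← hb₁, Function.update_eq_self]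
        exact ih
    | read p x =>
      exact .cons (M := TSO P Var Val) (.readFromMemory m b p x _ (by simp_all) rfl) ih
    | rmw p x vold vnew hv =>
      exact .cons (M := TSO P Var Val) (.rmw m b p x vold vnew hb₁ hv) ih
    | fence p => exact .cons (M := TSO P Var Val) (.fence m b p hb₁) ih

/-- The memory that results from propagating a buffer. -/
def flushBuffer (m : Var → Val) (l : List (Var × Val)) : Var → Val :=
  l.foldl (fun m w => Function.update m w.1 w.2) m

theorem flushBuffer_append_singleton (m : Var → Val) (l : List (Var × Val)) (x : Var) (v : Val) :
    flushBuffer m (l ++ [(x, v)]) = Function.update (flushBuffer m l) x v := by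
  simp [flushBuffer]

/-- The two alternatives match the two read rules of TSO: through its buffer, a process sees the
memory that flushing the buffer would produce. -/
theorem flushBuffer_apply (m : Var → Val) (l : List (Var × Val)) (x : Var) :
    (l.filter (fun w => w.1 = x) = [] ∧ flushBuffer m l x = m x) ∨
      (l.filter (fun w => w.1 = x)).getLast? = some (x, flushBuffer m l x) := by
  induction l using List.reverseRecOn with
  | nil => simp [flushBuffer]
  | append_singleton l w ih =>
    obtain ⟨y, v⟩ := w
    rw [flushBuffer_append_singleton]
    by_cases hy : y = x
    · subst hy
      simp
    · rw [Function.update_of_ne (Ne.symm hy)]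
      simpa [List.filter_append, hy] using ih

theorem TSO_orun_flush [Zero Val] (m : Var → Val) (l : List (Var × Val)) (b : P → List (Var × Val)) (p : P)
    (hb : b p = l) :
    (TSO P Var Val).ORun ⟨m, b⟩ [] ⟨flushBuffer m l, Function.update b p []⟩ := by
  induction l generalizing m b with
  | nil =>
    rw [← hb, Function.update_eq_self, hb]
    exact .refl (M := TSO P Var Val) _
  | cons w l ih =>
    refine .silent (M := TSO P Var Val) (.propagate m b p w.1 w.2 l hb) ?_
    simpa [flushBuffer] using ih (Function.update m w.1 w.2) (Function.update b p l) (by simp)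

/-- Reads and writes of a process can be executed without propagating the writes. -/
theorem TSO_orun_buffered [Zero Val] {m m₁ m₂ : Var → Val} {σ : List (MemEvent P Var Val)}
    (h : SCMRun m₁ σ m₂) (p : P) (b : P → List (Var × Val)) (hb : flushBuffer m (b p) = m₁)
    (hσ : ∀ e ∈ σ, e.proc = p ∧ e.type ≠ .F ∧ e.type ≠ .RMW) :
    ∃ l, (TSO P Var Val).ORun ⟨m, b⟩ σ ⟨m, Function.update b p l⟩ := by
  induction h generalizing b with
  | nil => exact ⟨b p, by simpa using .refl (M := TSO P Var Val) _⟩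
  | @cons m₁ m₂ m₃ e σ h _ ih =>
    have he := hσ e List.mem_cons_self
    have hσ' := fun e he => hσ e (List.mem_cons_of_mem _ he)
    cases h with
    | write p' x v =>
      obtain rfl : p' = p := he.1
      obtain ⟨l, hl⟩ := ih (Function.update b p' (b p' ++ [(x, v)]))
        (by simp [flushBuffer_append_singleton, hb]) hσ'
      rw [Function.update_idem] at hl
      exact ⟨l, .cons (M := TSO P Var Val) (.write m b p' x v) hl⟩
    | read p' x =>
      obtain rfl : p' = p := he.1
      obtain ⟨l, hl⟩ := ih b hb hσ'
      refine ⟨l, .cons (M := TSO P Var Val) ?_ hl⟩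
      rcases flushBuffer_apply m (b p') x with h | h <;> rw [hb] at h
      · exact .readFromMemory m b p' x _ h.1 h.2.symm
      · exact .readFromBuffer m b p' x _ h
    | rmw => exact absurd rfl he.2.2
    | fence => exact absurd rfl he.2.1

/-- The split is before the trailing fences. The writes of `σ` stay in the buffer of `p`, where the
other processes that execute `τ` cannot see them, and this buffer does not block their fences and
RMWs. It is flushed after `τ`, so that the trailing fences are enabled. -/
theorem TSO_merge [Zero Val] {m m₁ m₂ : Var → Val} {σ₀ σ τ : List (MemEvent P Var Val)} {p : P}
    (h₀ : SCMRun (fun _ => 0) σ₀ m) (hσ : SCMRun m σ m₁) (hτ : SCMRun m τ m₂)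
    (hp : ∀ e ∈ σ, e.proc = p) (hq : ∀ e ∈ τ, e.proc ≠ p)
    (hrmw : ¬ HasRMW σ) (hltf : IsLTF σ) :
    ∃ α β, σ = α ++ β ∧ σ₀ ++ (α ++ τ ++ β) ∈ (TSO P Var Val).otraces := by
  obtain ⟨a, b, c, rfl, ha, hb, hc⟩ := hltf.exists_split
  refine ⟨a ++ b, c, rfl, MemoryModel.mem_otraces_iff.2 ?_⟩
  obtain ⟨r', hab, -⟩ := SCMRun.append_iff.1 hσ
  obtain ⟨r, hra, hrb⟩ := SCMRun.append_iff.1 hab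
  -- The leading fences do not change the memory, so `b` and `τ` start from the same one.
  obtain rfl := hra.eq_of_no_write fun e he => by simp [ha e he]
  obtain ⟨l, hl⟩ := TSO_orun_buffered (m := r) hrb p (fun _ => []) rfl fun e he =>
    ⟨hp e (by simp [he]), hb e he, fun h => hrmw ⟨e, by simp [he], h⟩⟩
  have hc' := TSO_orun_of_SCMRun (P := P) (σ := c) (m := flushBuffer m₂ l)
    (m' := flushBuffer m₂ l) (by
      clear hp hrmw hltf hσ
      induction c with
      | nil => exact .nil _
      | cons e c ih =>
        rw [MemEvent.eq_fence_of_type (hc e (by simp))]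
        exact .cons (.fence _ _) (ih fun e he => hc e (by simp [he])))
    (fun _ => []) (by simp)
  have hfl := TSO_orun_flush m₂ l (Function.update (fun _ : P => []) p l) p (by simp)
  rw [Function.update_idem, Function.update_eq_self] at hfl
  have hτ' := TSO_orun_of_SCMRun hτ (Function.update (fun _ : P => []) p l) fun e he => by
    simp [Function.update_of_ne (hq e he)]
  have := ((TSO_orun_of_SCMRun h₀ (fun _ => []) (by simp)).append
    (((TSO_orun_of_SCMRun hra (fun _ => []) (by simp)).append hl).append hτ')).append
    (hfl.append hc')
  simp only [List.append_assoc, List.nil_append] at this ⊢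
  exact ⟨_, this⟩

end TSO

end Memory

/-! ### Release-acquire -/

section RA

variable {P Var Val : Type u}

/-- The messages of `s` are those of `A` and those of `B`. The messages of `A` implement the
memory `m`, with latest timestamps `L`. The messages of `B` have timestamps that are larger than
the latest ones by more than `N`, and are visible only to processes outside `Q`. -/
structure RAInv (Q : P → Prop) (N : ℕ) (m : Var → Val) (A B : Set (RAMessage Var Val))
    (L : Var → ℕ) (s : RAState P Var Val) : Prop where
  msgs_eq : s.msgs = A ∪ B
  view_le : ∀ μ ∈ A, μ.view ≤ L
  view_self : ∀ μ ∈ A, μ.view μ.var = μ.time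
  latest : ∀ x, ∃ U, (⟨x, m x, L x, U⟩ : RAMessage Var Val) ∈ A
  far : ∀ μ ∈ B, L μ.var + N < μ.time
  fview_le : s.fview ≤ L
  pview_le : ∀ p, Q p → s.pview p ≤ L

namespace RAInv

variable {Q Q' : P → Prop} {N N' : ℕ} {m m' : Var → Val} {A B : Set (RAMessage Var Val)}
  {L : Var → ℕ} {s : RAState P Var Val}

theorem mono (h : RAInv Q N m A B L s) (hN : N' ≤ N) (hQ : ∀ p, Q' p → Q p) :
    RAInv Q' N' m A B L s :=
  { h with
    far := fun μ hμ => lt_of_le_of_lt (by omega) (h.far μ hμ)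
    pview_le := fun p hp => h.pview_le p (hQ p hp) }

theorem time_le (h : RAInv Q N m A B L s) {μ : RAMessage Var Val} (hμ : μ ∈ A) :
    μ.time ≤ L μ.var :=
  h.view_self μ hμ ▸ h.view_le μ hμ μ.var

/-- Timestamps in `A` are at most `L`, and those in `B` lie beyond the gap, so a positive gap leaves
the next timestamp free. -/
theorem fresh (h : RAInv Q (N + 1) m A B L s) {x : Var} {μ : RAMessage Var Val}
    (hμ : μ ∈ s.msgs) (hx : μ.var = x) : μ.time ≠ L x + 1 := by
  subst hx
  rw [h.msgs_eq] at hμ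
  rcases hμ with hμ | hμ
  · have := h.time_le hμ
    omega
  · have := h.far μ hμ
    omega

variable [DecidableEq P] [DecidableEq Var]

/-- A process can learn the latest message of a variable. -/
theorem exists_sync [Zero Val] (h : RAInv Q N m A B L s) {p : P} (hp : Q p) (x : Var) :
    ∃ s', (RA P Var Val).ORun s [] s' ∧ RAInv Q N m A B L s' ∧ s'.pview p x = L x := by
  obtain ⟨U, hU⟩ := h.latest x
  have hle := h.pview_le p hp x
  -- Propagation is only enabled for a strictly smaller view. The view of the latest message is
  -- bounded by `L`, so learning it does not break `pview_le`.
  rcases hle.eq_or_lt with heq | hlt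
  · exact ⟨s, .refl (M := RA P Var Val) s, h, heq⟩
  · obtain ⟨msgs, V, F⟩ := s
    have hUx : U x = L x := h.view_self _ hU
    have hUL : U ≤ L := h.view_le _ hU
    refine ⟨⟨msgs, Function.update V p (V p ⊔ U), F⟩, .silent (M := RA P Var Val)
      (.propagate msgs V F p ⟨x, m x, L x, U⟩ ?_ hlt) (.refl (M := RA P Var Val) _), ?_, ?_⟩
    · have := h.msgs_eq
      simp only at this
      rw [this]
      exact .inl hU
    · refine { h with pview_le := fun p' hp' => ?_ }
      by_cases hpp : p' = p
      · subst hpp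
        simpa using ⟨h.pview_le _ hp, hUL⟩
      · simpa [Function.update_of_ne hpp] using h.pview_le p' hp'
    · simp only at hle
      simp [hUx, hle]

/-- Adding a message with the next timestamp. -/
theorem add_message {msgs : Set (RAMessage Var Val)} {V : P → Var → ℕ} {F : Var → ℕ}
    (h : RAInv Q (N + 1) m A B L ⟨msgs, V, F⟩) {p : P} (hp : Q p) (x : Var) (v : Val) :
    RAInv Q N (Function.update m x v)
      (A ∪ {⟨x, v, L x + 1, Function.update (V p) x (L x + 1)⟩}) B
      (Function.update L x (L x + 1))
      ⟨msgs ∪ {⟨x, v, L x + 1, Function.update (V p) x (L x + 1)⟩},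
        Function.update V p (Function.update (V p) x (L x + 1)), F⟩ := by
  have hL : L ≤ Function.update L x (L x + 1) := by
    rw [Pi.le_def]
    intro y
    by_cases hy : y = x
    · subst hy
      simp
    · simp [hy]
  have hV : Function.update (V p) x (L x + 1) ≤ Function.update L x (L x + 1) :=
    update_le_update_iff.2 ⟨le_rfl, fun y _ => h.pview_le p hp y⟩
  constructor
  · have := h.msgs_eq
    simp only at this
    rw [this]
    exact Set.union_right_comm _ _ _
  · rintro μ (hμ | rfl)
    · exact (h.view_le μ hμ).trans hL
    · exact hV
  · rintro μ (hμ | rfl)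
    · exact h.view_self μ hμ
    · simp
  · intro y
    by_cases hy : y = x
    · subst hy
      exact ⟨Function.update (V p) y (L y + 1), .inr (by simp)⟩
    · obtain ⟨U, hU⟩ := h.latest y
      exact ⟨U, .inl (by simpa [Function.update_of_ne hy] using hU)⟩
  · intro μ hμ
    -- Raising `L x` by one is paid for by the decrease of the gap from `N + 1` to `N`.
    have := h.far μ hμ
    by_cases hy : μ.var = x
    · rw [hy] at this ⊢
      simp only [Function.update_self]
      omega
    · rw [Function.update_of_ne hy]
      omega
  · exact le_trans h.fview_le hL
  · intro p' hp'
    by_cases hpp : p' = p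
    · subst hpp
      simpa using hV
    · simpa [Function.update_of_ne hpp] using (h.pview_le p' hp').trans hL

/-- The processes of `Q` can simulate strongly consistent memory. -/
theorem exists_orun [Zero Val] {σ : List (MemEvent P Var Val)} (hσ : SCMRun m σ m')
    (h : RAInv Q (N + σ.length) m A B L s) (hQ : ∀ e ∈ σ, Q e.proc) :
    ∃ A' L' s', (RA P Var Val).ORun s σ s' ∧ RAInv Q N m' A' B L' s' := by
  induction hσ generalizing A L s with
  | nil => exact ⟨A, L, s, .refl (M := RA P Var Val) s, h⟩
  | @cons m m₁ m₂ e σ hstep _ ih =>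
    have hQ' : ∀ e ∈ σ, Q e.proc := fun e he => hQ e (List.mem_cons_of_mem _ he)
    have hp : Q e.proc := hQ e List.mem_cons_self
    rw [List.length_cons, ← Nat.add_assoc] at h
    -- Each event costs at most one unit of the gap, so one event at a time suffices.
    suffices H : ∃ A' L' s', (RA P Var Val).ORun s [e] s' ∧
        RAInv Q (N + σ.length) m₁ A' B L' s' by
      obtain ⟨A₁, L₁, s₁, hs₁, h₁⟩ := H
      obtain ⟨A₂, L₂, s₂, hs₂, h₂⟩ := ih h₁ hQ'
      exact ⟨A₂, L₂, s₂, hs₁.append hs₂, h₂⟩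
    have one {t t' : RAState P Var Val} (ht : (RA P Var Val).ORun s [] t)
        (hstep : RAStep t (some e) t') : (RA P Var Val).ORun s [e] t' :=
      ht.append (.cons (M := RA P Var Val) hstep (.refl (M := RA P Var Val) t'))
    cases hstep with
    | write p x v =>
      obtain ⟨⟨msgs, V, F⟩, hs', h', hx⟩ := h.exists_sync hp x
      exact ⟨_, _, _, one hs' (.write msgs V F p x v (L x + 1)
        (by simp only at hx; omega) fun μ hμ hμx => h'.fresh hμ hμx), h'.add_message hp x v⟩
    | read p x =>
      obtain ⟨⟨msgs, V, F⟩, hs', h', hx⟩ := h.exists_sync hp x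
      simp only at hx
      obtain ⟨U, hU⟩ := h'.latest x
      rw [← hx] at hU
      have hU' : (⟨x, m x, V p x, U⟩ : RAMessage Var Val) ∈ msgs :=
        h'.msgs_eq.symm.subset (.inl hU)
      exact ⟨_, _, _, one hs' (.read msgs V F p x (m x) U hU'), h'.mono (by omega) fun _ => id⟩
    | rmw p x vold vnew hv =>
      obtain ⟨⟨msgs, V, F⟩, hs', h', hx⟩ := h.exists_sync hp x
      simp only at hx
      obtain ⟨U, hU⟩ := h'.latest x
      rw [← hx, hv] at hU
      have hU' : (⟨x, vold, V p x, U⟩ : RAMessage Var Val) ∈ msgs :=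
        h'.msgs_eq.symm.subset (.inl hU)
      have hinv := h'.add_message hp x vnew
      rw [← hx] at hinv
      exact ⟨_, _, _, one hs' (.rmw msgs V F p x vold vnew U hU'
        fun μ hμ hμx => hx ▸ h'.fresh hμ hμx), hinv⟩
    | fence p =>
      obtain ⟨msgs, V, F⟩ := s
      have hle : V p ⊔ F ≤ L := sup_le (h.pview_le p hp) h.fview_le
      refine ⟨A, L, _, one (.refl (M := RA P Var Val) _) (.fence msgs V F p), ?_⟩
      refine { h.mono (N' := N + σ.length) (by omega) (fun _ => id) with
        fview_le := hle, pview_le := fun p' hp' => ?_ }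
      by_cases hpp : p' = p
      · subst hpp
        simpa using hle
      · simpa [Function.update_of_ne hpp] using h.pview_le p' hp'

/-- Reads and writes of a process can be executed with messages that no other process sees. -/
theorem exists_orun_hidden [Zero Val] {m₁ m₂ : Var → Val} {σ : List (MemEvent P Var Val)} {p : P}
    (hσ : SCMRun m₁ σ m₂) (h : RAInv (· ≠ p) N m A B L s)
    (hown : ∀ μ ∈ B, μ.time ≤ s.pview p μ.var)
    (hloc : ∀ x, s.pview p x ≤ L x ∧ m₁ x = m x ∨
      L x < s.pview p x ∧ ∃ U, (⟨x, m₁ x, s.pview p x, U⟩ : RAMessage Var Val) ∈ s.msgs)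
    (hp : ∀ e ∈ σ, e.proc = p ∧ e.type ≠ .F ∧ e.type ≠ .RMW) :
    ∃ B' s', (RA P Var Val).ORun s σ s' ∧ RAInv (· ≠ p) N m A B' L s' := by
  -- Here `m` is the memory that the other processes see and `m₁` the one that `p` sees. By `hloc`
  -- they agree where the view of `p` does not exceed `L`; elsewhere `p` reads the message at its
  -- own view. By `hown`, any timestamp above the view of `p` is unused in `B`.
  induction hσ generalizing B s with
  | nil => exact ⟨B, s, .refl (M := RA P Var Val) s, h⟩
  | @cons m₁ m₂ m₃ e σ hstep _ ih =>
    have he := hp e List.mem_cons_self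
    have hp' := fun e he => hp e (List.mem_cons_of_mem _ he)
    obtain ⟨msgs, V, F⟩ := s
    simp only at hloc hown
    have hms : msgs = A ∪ B := h.msgs_eq
    cases hstep with
    | write p' x v =>
      obtain rfl : p' = p := he.1
      -- The first bound keeps the gap for the other processes; the second makes the write legal
      -- and, with `hown`, the timestamp fresh in `B`.
      set t := max (L x + N) (V p' x) + 1 with ht
      have ht₁ : L x + N < t := by omega
      have ht₂ : V p' x < t := by omega
      have hinv : RAInv (· ≠ p') N m A (B ∪ {⟨x, v, t, Function.update (V p') x t⟩}) L
          ⟨msgs ∪ {⟨x, v, t, Function.update (V p') x t⟩},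
            Function.update V p' (Function.update (V p') x t), F⟩ := by
        refine { h with
          msgs_eq := by simp only [hms, Set.union_assoc]
          far := ?_
          pview_le := fun q hq => by simpa [Function.update_of_ne hq] using h.pview_le q hq }
        rintro μ (hμ | rfl)
        · exact h.far μ hμ
        · exact ht₁
      obtain ⟨B', s', hs', h'⟩ := ih hinv
        (by
          rintro μ (hμ | rfl)
          · by_cases hx : μ.var = x
            · have := hown μ hμ
              simp only [hx] at this
              simp only [Function.update_self, hx]
              omega
            · simpa [Function.update_of_ne hx] using hown μ hμ
          · simp)
        (by
          intro y
          by_cases hy : y = x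
          · subst hy
            right
            simp only [Function.update_self]
            exact ⟨by omega, _, .inr rfl⟩
          · simp only [Function.update_self, Function.update_of_ne hy]
            rcases hloc y with h | ⟨h, U, hU⟩
            · exact .inl h
            · exact .inr ⟨h, U, .inl hU⟩)
        hp'
      refine ⟨B', s', .cons (M := RA P Var Val) (.write msgs V F p' x v t ht₂ ?_) hs', h'⟩
      intro μ hμ hx
      subst hx
      rw [hms] at hμ
      rcases hμ with hμ | hμ
      · have := h.time_le hμ
        omega
      · have := hown μ hμ
        omega
    | read p' x =>
      obtain rfl : p' = p := he.1
      -- A view below `L x` may point to an outdated message or to none, so the latest message of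
      -- `A` is propagated first. Its view is at most `L` and hence does not affect variables where
      -- `p` is already above `L`.
      rcases lt_or_ge (V p' x) (L x) with hlt | hge
      · obtain ⟨U, hU⟩ := h.latest x
        have hUx : U x = L x := h.view_self _ hU
        have hUL : U ≤ L := h.view_le _ hU
        have hUm : (⟨x, m x, L x, U⟩ : RAMessage Var Val) ∈ msgs := hms ▸ .inl hU
        have hVx : (V p' ⊔ U) x = L x := by
          simp only [Pi.sup_apply, hUx]
          omega
        have hmx : m₁ x = m x := by
          rcases hloc x with h | h
          · exact h.2
          · omega
        obtain ⟨B', s', hs', h'⟩ := ih (B := B) (s := ⟨msgs, Function.update V p' (V p' ⊔ U), F⟩)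
          { h with
            pview_le := fun q hq => by simpa [Function.update_of_ne hq] using h.pview_le q hq }
          (fun μ hμ => by simp [hown μ hμ])
          (by
            intro y
            have hy : U y ≤ L y := hUL y
            simp only [Function.update_self, Pi.sup_apply]
            rcases hloc y with h | h
            · exact .inl ⟨sup_le h.1 hy, h.2⟩
            · rw [sup_of_le_left (hy.trans h.1.le)]
              exact .inr h)
          hp'
        refine ⟨B', s', .silent (M := RA P Var Val) (.propagate msgs V F p' _ hUm hlt)
          (.cons (M := RA P Var Val) (.read _ _ _ p' x _ U ?_) hs'), h'⟩
        simpa [hVx, hmx, hUx] using hUm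
      · obtain ⟨B', s', hs', h'⟩ := ih h hown hloc hp'
        obtain ⟨U, hU⟩ : ∃ U, (⟨x, m₁ x, V p' x, U⟩ : RAMessage Var Val) ∈ msgs := by
          rcases hloc x with hx | hx
          · obtain ⟨U, hU⟩ := h.latest x
            rw [hx.2, le_antisymm hx.1 hge]
            exact ⟨U, hms ▸ .inl hU⟩
          · exact hx.2
        exact ⟨B', s', .cons (M := RA P Var Val) (.read msgs V F p' x _ U hU) hs', h'⟩
    | rmw => exact absurd rfl he.2.2
    | fence => exact absurd rfl he.2.1

end RAInv

variable [DecidableEq P] [DecidableEq Var]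

theorem RA_init_inv [Zero Val] (N : ℕ) :
    RAInv (P := P) (fun _ => True) N (fun _ => 0) {μ | ∃ x : Var, μ = ⟨x, 0, 0, fun _ => 0⟩} ∅
      (fun _ => 0) (RA P Var Val).init where
  msgs_eq := (Set.union_empty _).symm
  view_le := by rintro _ ⟨x, rfl⟩; exact le_rfl
  view_self := by rintro _ ⟨x, rfl⟩; rfl
  latest x := ⟨_, x, rfl⟩
  far _ h := h.elim
  fview_le := le_rfl
  pview_le _ _ := le_rfl

/-- RA fences are always enabled, so the trailing ones may run even when the view of their process
includes hidden messages. -/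
theorem RA_orun_fences [Zero Val] (s : RAState P Var Val) {σ : List (MemEvent P Var Val)}
    (hσ : ∀ e ∈ σ, e.type = .F) : ∃ s', (RA P Var Val).ORun s σ s' := by
  induction σ generalizing s with
  | nil => exact ⟨s, .refl (M := RA P Var Val) s⟩
  | cons e σ ih =>
    obtain ⟨s', h⟩ := ih ⟨s.msgs, _, _⟩ fun e he => hσ e (by simp [he])
    rw [MemEvent.eq_fence_of_type (hσ e (by simp))]
    exact ⟨s', .cons (M := RA P Var Val) (.fence s.msgs s.pview s.fview e.proc) h⟩

/-- The middle block of `σ` has no fence, so the fence view stays below the hidden messages and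
fences in `τ` do not reveal them. The trailing fences of `σ`, which would, come after `τ`. -/
theorem RA_merge [Zero Val] {m m₁ m₂ : Var → Val} {σ₀ σ τ : List (MemEvent P Var Val)} {p : P}
    (h₀ : SCMRun (fun _ => 0) σ₀ m) (hσ : SCMRun m σ m₁) (hτ : SCMRun m τ m₂)
    (hp : ∀ e ∈ σ, e.proc = p) (hq : ∀ e ∈ τ, e.proc ≠ p)
    (hrmw : ¬ HasRMW σ) (hltf : IsLTF σ) :
    ∃ α β, σ = α ++ β ∧ σ₀ ++ (α ++ τ ++ β) ∈ (RA P Var Val).otraces := by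
  obtain ⟨a, b, c, rfl, ha, hb, hc⟩ := hltf.exists_split
  refine ⟨a ++ b, c, rfl, MemoryModel.mem_otraces_iff.2 ?_⟩
  obtain ⟨r', hab, -⟩ := SCMRun.append_iff.1 hσ
  obtain ⟨r, hra, hrb⟩ := SCMRun.append_iff.1 hab
  obtain rfl := hra.eq_of_no_write fun e he => by simp [ha e he]
  -- The gap is one unit per event: `σ₀ ++ a` uses up its share before the hidden messages are
  -- placed, which leaves `τ.length` units below them.
  obtain ⟨A, L, s, hs, hinv⟩ := (RA_init_inv (P := P) (Var := Var) (Val := Val)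
    (0 + τ.length + (σ₀ ++ a).length)).exists_orun (SCMRun.append_iff.2 ⟨_, h₀, hra⟩)
    fun _ _ => trivial
  obtain ⟨B, s₁, hs₁, hinv₁⟩ := (hinv.mono le_rfl (Q' := (· ≠ p))
    fun _ _ => trivial).exists_orun_hidden hrb (fun _ h => h.elim)
    (fun x => .inl ⟨hinv.pview_le p trivial x, rfl⟩)
    fun e he => ⟨hp e (by simp [he]), hb e he, fun h => hrmw ⟨e, by simp [he], h⟩⟩
  obtain ⟨A₂, L₂, s₂, hs₂, -⟩ := hinv₁.exists_orun hτ hq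
  obtain ⟨s₃, hs₃⟩ := RA_orun_fences s₂ hc
  exact ⟨s₃, by simpa using ((hs.append hs₁).append hs₂).append hs₃⟩

end RA

/-! ### Sequential histories and linearizations -/

section Histories

variable {P : Type u} {Op : Type v} {Ret : Type w}

/-- The complete sequential history of a list of operations. -/
def seqHist (l : List (P × Op × Ret)) : List (ObjEvent P Op Ret) :=
  l.flatMap fun a => invRes a.1 a.2.1 a.2.2

theorem seqHist_nil : seqHist ([] : List (P × Op × Ret)) = [] := rfl

theorem seqHist_cons (a : P × Op × Ret) (l : List (P × Op × Ret)) :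
    seqHist (a :: l) = ⟨a.1, .inv a.2.1⟩ :: ⟨a.1, .res a.2.2⟩ :: seqHist l := rfl

theorem seqHist_append (l l' : List (P × Op × Ret)) :
    seqHist (l ++ l') = seqHist l ++ seqHist l' := List.flatMap_append

theorem length_seqHist (l : List (P × Op × Ret)) : (seqHist l).length = 2 * l.length := by
  induction l with
  | nil => rfl
  | cons a l ih => simp only [seqHist_cons, List.length_cons, ih]; omega

theorem eq_seqHist_of_prefix {h : List (ObjEvent P Op Ret)} {l : List (P × Op × Ret)}
    (hp : h <+: seqHist l) (hlast : ∀ e, h.getLast? = some e → e.IsRes) :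
    ∃ l', h = seqHist l' := by
  induction l generalizing h with
  | nil => exact ⟨[], List.prefix_nil.1 hp⟩
  | cons a l ih =>
    rw [seqHist_cons] at hp
    match h, hp, hlast with
    | [], _, _ => exact ⟨[], rfl⟩
    | [e], hp, hlast =>
      obtain ⟨r, hr⟩ := hlast e rfl
      rw [(List.cons_prefix_cons.1 hp).1] at hr
      cases hr
    | e :: e' :: h, hp, hlast =>
      rw [List.cons_prefix_cons, List.cons_prefix_cons] at hp
      obtain ⟨rfl, rfl, hp⟩ := hp
      obtain ⟨l', rfl⟩ := ih hp fun e he => hlast e (by simp [List.getLast?_cons, he])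
      exact ⟨a :: l', rfl⟩

section

variable [DecidableEq P]

theorem IsCSH.exists_eq_seqHist {h : List (ObjEvent P Op Ret)} (hh : IsCSH h) :
    ∃ l, h = seqHist l := by
  obtain ⟨⟨-, hc⟩, l, hl⟩ := hh
  refine eq_seqHist_of_prefix hl fun e he => hc e.proc e ?_
  obtain ⟨h', rfl⟩ := List.getLast?_eq_some_iff.1 he
  simp [restrictProc]

theorem isCompleteHist_seqHist (l : List (P × Op × Ret)) : IsCompleteHist (seqHist l) := by
  have key (p : P) : restrictProc (seqHist l) p = seqHist (l.filter fun a => a.1 = p) := by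
    induction l with
    | nil => rfl
    | cons a l ih =>
      unfold restrictProc at ih ⊢
      by_cases ha : a.1 = p
      · simp [seqHist_cons, ha, ih]
      · simp [seqHist_cons, ha, ih]
  have hlast (l : List (P × Op × Ret)) (e) (he : (seqHist l).getLast? = some e) : e.IsRes := by
    induction l using List.reverseRecOn with
    | nil => simp [seqHist_nil] at he
    | append_singleton l a _ =>
      rw [seqHist_append] at he
      simp [seqHist_cons, seqHist_nil, List.getLast?_append, List.getLast?_cons] at he
      exact ⟨_, by rw [← he]⟩
  refine ⟨fun p => ?_, fun p e he => hlast _ e (by rwa [key] at he)⟩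
  rw [key]
  exact ⟨_, List.prefix_rfl⟩

theorem isCSH_seqHist (l : List (P × Op × Ret)) : IsCSH (seqHist l) :=
  ⟨isCompleteHist_seqHist l, l, List.prefix_rfl⟩

/-- Completeness depends only on the restrictions to the processes. -/
theorem isCompleteHist_of_forall {h : List (ObjEvent P Op Ret)}
    (H : ∀ p, ∃ l : List (P × Op × Ret), restrictProc h p = restrictProc (seqHist l) p) :
    IsCompleteHist h := by
  refine ⟨fun p => ?_, fun p e he => ?_⟩ <;> obtain ⟨l, hl⟩ := H p
  · rw [hl]
    exact (isCompleteHist_seqHist l).1 p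
  · rw [hl] at he
    exact (isCompleteHist_seqHist l).2 p e he

end

theorem IsLongestCommonPrefix.of_ne {X : Type u} (c s t : List X) {a b : X} (h : a ≠ b) :
    IsLongestCommonPrefix c (c ++ a :: s) (c ++ b :: t) := by
  refine ⟨List.prefix_append _ _, List.prefix_append _ _, fun d h₁ h₂ => ?_⟩
  rcases List.prefix_or_prefix_of_prefix h₁ (List.prefix_append c (a :: s)) with hd | ⟨d', rfl⟩
  · exact hd
  · cases d' with
    | nil => simp
    | cons x d' =>
      rw [List.prefix_append_right_inj, List.cons_prefix_cons] at h₁ h₂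
      exact absurd (h₁.1.symm.trans h₂.1) h

/-- In the specification of a deterministic object, a response is determined by the past. -/
theorem ConcObject.Deterministic.res_unique [DecidableEq P] {O : ConcObject P Op Ret}
    (hdet : O.Deterministic) {h : List (ObjEvent P Op Ret)} {p : P} {o : Op} {u u' : Ret}
    (hu : h ++ invRes p o u ∈ O.spec) (hu' : h ++ invRes p o u' ∈ O.spec) : u = u' := by
  by_contra hne
  refine hdet ⟨_, hu, _, hu', h ++ [⟨p, .inv o⟩], ⟨p, .inv o⟩, ?_, by simp, o, rfl⟩
  have := IsLongestCommonPrefix.of_ne (h ++ [⟨p, .inv o⟩]) [] []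
    (a := (⟨p, .res u⟩ : ObjEvent P Op Ret)) (b := ⟨p, .res u'⟩) (by simpa using hne)
  simpa [invRes] using this

theorem getElem?_seqHist {l : List (P × Op × Ret)} {c : ℕ} (hc : c < l.length) :
    ∃ p o r, (seqHist l)[2 * c]? = some ⟨p, .inv o⟩ ∧
      (seqHist l)[2 * c + 1]? = some ⟨p, .res r⟩ := by
  induction l generalizing c with
  | nil => simp at hc
  | cons a l ih =>
    rw [seqHist_cons]
    cases c with
    | zero => exact ⟨a.1, a.2.1, a.2.2, rfl, rfl⟩
    | succ c =>
      obtain ⟨p, o, r, h₁, h₂⟩ := ih (c := c) (by simpa using hc)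
      exact ⟨p, o, r, by simpa [Nat.mul_add] using h₁, by simpa [Nat.mul_add] using h₂⟩

/-- A bijection between initial segments fixes the numbers below `k`
if they are mapped below the images of all larger numbers. -/
theorem Fin.equiv_fixes_of_lt {n n' : ℕ} (f : Fin n ≃ Fin n') (k : ℕ)
    (hf : ∀ i j : Fin n, i.val < k → i < j → f i < f j) (i : Fin n) (hi : i.val < k) :
    (f i).val = i.val := by
  have hn : n = n' := by simpa using Fintype.card_congr f
  subst hn
  obtain ⟨i, hin⟩ := i
  induction i using Nat.strong_induction_on with
  | _ i ih =>
    simp only at hi ih ⊢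
    -- If `f j` is below `i`, it is a fixed point by induction, and injectivity gives `f j = j`.
    have hle : ∀ j : Fin n, (f j).val < i → (f j).val = j.val := by
      intro j hj
      have h₁ := ih (f j).val hj (f j).isLt (by omega)
      have h₂ : f (f j) = f j := Fin.ext h₁
      rw [f.injective h₂]
    -- The preimage `j` of `i` is `i` itself: a smaller `j` is fixed, and a larger one would force
    -- `f i < i`, whence `f i = i` by `hle`.
    obtain ⟨j, hj⟩ := f.surjective ⟨i, hin⟩
    have hjv : (f j).val = i := by rw [hj]
    rcases lt_trichotomy j.val i with h | h | h
    · have := ih j.val h j.isLt (by omega)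
      simp only [Fin.eta] at this
      omega
    · obtain rfl : j = ⟨i, hin⟩ := Fin.ext h
      exact hjv
    · have hlt := hf ⟨i, hin⟩ j hi h
      rw [Fin.lt_def, hjv] at hlt
      have := hle _ hlt
      simp only at this
      omega

/-- A linearization of a complete sequential history followed by `t` starts with that history,
if every response in `t` is preceded in `t` by an invocation of the same process. -/
theorem Linearizes.exists_append {l : List (P × Op × Ret)} {s t h' : List (ObjEvent P Op Ret)}
    (h : Linearizes s h') (hs : s = seqHist l ++ t)
    (ht : ∀ (d : ℕ) (e : ObjEvent P Op Ret), t[d]? = some e →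
      e.IsInv ∨ ∃ d' < d, ∃ e', t[d']? = some e' ∧ e'.IsInv ∧ e'.proc = e.proc) :
    ∃ t', h' = seqHist l ++ t' := by
  obtain ⟨f, hget, hlt⟩ := h
  have hlen := length_seqHist l
  have step (i j : Fin s.length) (hij : i < j) (e e' : ObjEvent P Op Ret)
      (he : s[i.val]? = some e) (he' : s[j.val]? = some e') (hr : linRel e e') : f i < f j := by
    apply hlt i j hij
    rw [List.getElem?_eq_getElem i.isLt, Option.some_inj] at he
    rw [List.getElem?_eq_getElem j.isLt, Option.some_inj] at he'
    simpa only [List.get_eq_getElem, he, he'] using hr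
  have hl {c : ℕ} (hc : c < l.length) : ∃ p o r, s[2 * c]? = some ⟨p, .inv o⟩ ∧
      s[2 * c + 1]? = some ⟨p, .res r⟩ := by
    obtain ⟨p, o, r, h₁, h₂⟩ := getElem?_seqHist hc
    exact ⟨p, o, r, by rw [hs, List.getElem?_append_left (by omega), h₁],
      by rw [hs, List.getElem?_append_left (by omega), h₂]⟩
  -- A response of the sequential part stays before every later event: before invocations directly,
  -- and before a response because its own invocation lies in between.
  have odd (c : ℕ) (hc : c < l.length) (hc' : 2 * c + 1 < s.length) (j : Fin s.length)
      (hj : 2 * c + 1 < j.val) : f ⟨2 * c + 1, hc'⟩ < f j := by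
    obtain ⟨p, o, r, h₁, h₂⟩ := hl hc
    have toInv (j : Fin s.length) (hj : 2 * c + 1 < j.val) (e) (he : s[j.val]? = some e)
        (hi : e.IsInv) : f ⟨2 * c + 1, hc'⟩ < f j :=
      step _ j hj _ e h₂ he (.inr ⟨⟨r, rfl⟩, hi⟩)
    obtain ⟨j, hjs⟩ := j
    simp only at hj
    by_cases hjl : j < 2 * l.length
    · obtain ⟨c', rfl | rfl⟩ : ∃ c', j = 2 * c' ∨ j = 2 * c' + 1 := ⟨j / 2, by omega⟩
      · obtain ⟨p', o', r', h₁', -⟩ := hl (c := c') (by omega)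
        exact toInv _ hj _ h₁' ⟨o', rfl⟩
      · obtain ⟨p', o', r', h₁', h₂'⟩ := hl (c := c') (by omega)
        exact (toInv ⟨2 * c', by omega⟩ (by simp only; omega) _ h₁' ⟨o', rfl⟩).trans
          (step ⟨2 * c', by omega⟩ ⟨2 * c' + 1, hjs⟩ (by simp [Fin.lt_def]) _ _ h₁' h₂'
            (.inl rfl))
    · have hjt (d : ℕ) : s[2 * l.length + d]? = t[d]? := by
        rw [hs, List.getElem?_append_right (by omega), hlen, Nat.add_sub_cancel_left]
      obtain ⟨d, rfl⟩ : ∃ d, j = 2 * l.length + d := ⟨j - 2 * l.length, by omega⟩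
      have hd := List.getElem?_eq_getElem hjs
      rcases ht d _ ((hjt d).symm.trans hd) with hi | ⟨d', hd', e', he', hi, hp⟩
      · exact toInv _ hj _ hd hi
      · exact (toInv ⟨2 * l.length + d', by omega⟩ (by simp only; omega) e'
          ((hjt d').trans he') hi).trans
          (step ⟨2 * l.length + d', by omega⟩ ⟨2 * l.length + d, hjs⟩ (by simpa using hd')
            _ _ ((hjt d').trans he') hd (.inl hp))
  -- An invocation, at an even index, stays before its own response, and then `odd` applies.
  have fixed := Fin.equiv_fixes_of_lt f (2 * l.length) (by
    rintro ⟨i, his⟩ j hi hij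
    simp only at hi
    rw [Fin.lt_def] at hij
    simp only at hij
    obtain ⟨c, rfl | rfl⟩ : ∃ c, i = 2 * c ∨ i = 2 * c + 1 := ⟨i / 2, by omega⟩
    · have hc : c < l.length := by omega
      have hc' : 2 * c + 1 < s.length := by omega
      obtain ⟨p, o, r, h₁, h₂⟩ := hl hc
      have h01 : f ⟨2 * c, his⟩ < f ⟨2 * c + 1, hc'⟩ :=
        step _ _ (by simp [Fin.lt_def]) _ _ h₁ h₂ (.inl rfl)
      by_cases hj : j.val = 2 * c + 1
      · obtain rfl : j = ⟨2 * c + 1, hc'⟩ := Fin.ext hj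
        exact h01
      · exact h01.trans (odd c hc hc' j (by omega))
    · exact odd c (by omega) his j hij)
  suffices hpre : seqHist l <+: h' by
    obtain ⟨t', rfl⟩ := hpre
    exact ⟨t', rfl⟩
  rw [List.prefix_iff_getElem?]
  intro i hi
  have his : i < s.length := by
    rw [hs, List.length_append]
    omega
  have h₁ := fixed ⟨i, his⟩ (by simp only; omega)
  have h₂ := hget ⟨i, his⟩
  rw [List.get_eq_getElem, List.get_eq_getElem] at h₂
  rw [List.getElem?_eq_some_iff]
  refine ⟨h₁.symm.trans_lt (f ⟨i, his⟩).isLt, ?_⟩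
  simp only [h₁] at h₂
  rw [← h₂]
  subst hs
  exact List.getElem_append_left hi

theorem IsReordering.perm {X : Type u} {R : X → X → Prop} {s s' : List X}
    (h : IsReordering R s s') : s.Perm s' := by
  obtain ⟨f, hf, -⟩ := h
  have key (l : List X) : (l : Multiset X) = Finset.univ.val.map l.get := by
    rw [Fin.univ_val_map, List.ofFn_get]
  rw [← Multiset.coe_eq_coe, key s, key s', ← Multiset.map_univ_val_equiv f, Multiset.map_map]
  exact congrArg (Multiset.map · _) (funext hf)

/-- The linearizations of two overlapping operations after a complete sequential history. -/
theorem Linearizes.overlapping [DecidableEq P] {h₀ h' : List (ObjEvent P Op Ret)} {p₁ p₂ : P}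
    {o₁ o₂ : Op} {u₁ u₂ : Ret} (hp : p₁ ≠ p₂) (h₀c : IsCSH h₀) (h'c : IsCSH h')
    (h : Linearizes (h₀ ++ [⟨p₁, .inv o₁⟩, ⟨p₂, .inv o₂⟩, ⟨p₂, .res u₂⟩, ⟨p₁, .res u₁⟩]) h') :
    h' = h₀ ++ invRes p₁ o₁ u₁ ++ invRes p₂ o₂ u₂ ∨
      h' = h₀ ++ invRes p₂ o₂ u₂ ++ invRes p₁ o₁ u₁ := by
  obtain ⟨l, rfl⟩ := h₀c.exists_eq_seqHist
  obtain ⟨l', rfl⟩ := h'c.exists_eq_seqHist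
  obtain ⟨t, ht⟩ := h.exists_append rfl (by
    intro d e he
    match d, he with
    | 0, he => cases he; exact .inl ⟨_, rfl⟩
    | 1, he => cases he; exact .inl ⟨_, rfl⟩
    | 2, he => cases he; exact .inr ⟨1, by omega, _, rfl, ⟨_, rfl⟩, rfl⟩
    | 3, he => cases he; exact .inr ⟨0, by omega, _, rfl, ⟨_, rfl⟩, rfl⟩)
  have hperm := IsReordering.perm h
  rw [ht, List.perm_append_left_iff] at hperm
  obtain ⟨l'', rfl⟩ : ∃ l'', t = seqHist l'' := by
    clear hperm h h'c h₀c
    induction l generalizing l' with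
    | nil => exact ⟨l', ht.symm⟩
    | cons a l ih =>
      cases l' with
      | nil => simp [seqHist_nil, seqHist_cons] at ht
      | cons a' l' =>
        simp only [seqHist_cons, List.cons_append, List.cons.injEq] at ht
        exact ih l' ht.2.2
  rw [ht]
  -- Four events remain, hence two operations; the process of the first one decides the order.
  have hlen := hperm.length_eq
  rw [length_seqHist] at hlen
  match l'', hlen with
  | [(a, b, c), (a', b', c')], _ =>
    simp only [seqHist_cons, seqHist_nil] at hperm ⊢
    have m₁ := hperm.subset (a := ⟨p₁, .inv o₁⟩) (by simp)
    have m₂ := hperm.subset (a := ⟨p₂, .inv o₂⟩) (by simp)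
    have m₃ := hperm.subset (a := ⟨p₂, .res u₂⟩) (by simp)
    have m₄ := hperm.subset (a := ⟨p₁, .res u₁⟩) (by simp)
    simp at m₁ m₂ m₃ m₄
    rcases m₁ with ⟨rfl, rfl⟩ | ⟨rfl, rfl⟩
    · left
      rcases m₂ with ⟨rfl, rfl⟩ | ⟨rfl, rfl⟩
      · exact absurd rfl hp
      · simp_all [invRes, Ne.symm hp]
    · right
      rcases m₂ with ⟨rfl, rfl⟩ | ⟨rfl, rfl⟩
      · simp_all [invRes, Ne.symm hp]
      · exact absurd rfl hp

end Histories

/-! ### Runs of implementations -/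

section Implementations

variable {P Var Val : Type u} {Op : Type v} {Ret : Type w}

theorem restrictMem_append (π π' : List (Event P Var Val Op Ret)) :
    restrictMem (π ++ π') = restrictMem π ++ restrictMem π' := List.filterMap_append

theorem restrictObj_append (π π' : List (Event P Var Val Op Ret)) :
    restrictObj (π ++ π') = restrictObj π ++ restrictObj π' := List.filterMap_append

theorem restrictMem_cons_mem (e : MemEvent P Var Val) (π : List (Event P Var Val Op Ret)) :
    restrictMem (.mem e :: π) = e :: restrictMem π := rfl

theorem restrictMem_cons_obj (e : ObjEvent P Op Ret) (π : List (Event P Var Val Op Ret)) :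
    restrictMem (.obj e :: π) = restrictMem π := rfl

theorem restrictObj_cons_mem (e : MemEvent P Var Val) (π : List (Event P Var Val Op Ret)) :
    restrictObj (.mem e :: π) = restrictObj π := rfl

theorem restrictObj_cons_obj (e : ObjEvent P Op Ret) (π : List (Event P Var Val Op Ret)) :
    restrictObj (.obj e :: π) = e :: restrictObj π := rfl

theorem restrictMem_map_mem (σ : List (MemEvent P Var Val)) :
    restrictMem (σ.map (Event.mem : _ → Event P Var Val Op Ret)) = σ := by
  induction σ with
  | nil => rfl
  | cons e σ ih => rw [List.map_cons, restrictMem_cons_mem, ih]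

theorem restrictObj_map_mem (σ : List (MemEvent P Var Val)) :
    restrictObj (σ.map (Event.mem : _ → Event P Var Val Op Ret)) = [] := by
  induction σ with
  | nil => rfl
  | cons e σ ih => rw [List.map_cons, restrictObj_cons_mem, ih]

namespace Implementation

variable {I : Implementation.{u, v, w, z} P Var Val Op Ret}

theorem proc_eq_of_run {o : Op} {p : P} {q q' : (I o p).State}
    {π : List (Event P Var Val Op Ret)} (h : (I o p).Run q π q') : ∀ e ∈ π, e.proc = p := by
  induction π generalizing q with
  | nil => simp
  | cons e π ih =>
    obtain ⟨r, h, h'⟩ := h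
    intro e' he'
    rcases List.mem_cons.1 he' with rfl | he'
    · exact (I o p).proc_eq _ _ _ h
    · exact ih h' e' he'

variable [DecidableEq P]

/-- States of the system: `none` for an idle process. -/
abbrev SysState (I : Implementation.{u, v, w, z} P Var Val Op Ret) :=
  (p : P) → Option (Σ o : Op, (I o p).State)

/-- Runs of the system induced by an implementation. -/
inductive SysRun (I : Implementation.{u, v, w, z} P Var Val Op Ret) :
    I.SysState → List (Event P Var Val Op Ret) → I.SysState → Prop
  | nil (q : I.SysState) : SysRun I q [] q
  | cons {q q' : I.SysState} {e : Event P Var Val Op Ret} {π : List (Event P Var Val Op Ret)}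
      (p : P) {r : Option (Σ o : Op, (I o p).State)} (h : I.ProcStep p (q p) e r)
      (h' : SysRun I (Function.update q p r) π q') : SysRun I q (e :: π) q'

theorem sys_run_iff {q q' : I.SysState} {π : List (Event P Var Val Op Ret)} :
    I.sys.Run q π q' ↔ I.SysRun q π q' := by
  constructor
  · intro h
    induction π generalizing q with
    | nil =>
      change q = q' at h
      exact h ▸ .nil q
    | cons e π ih =>
      obtain ⟨_, ⟨p, r, h, rfl⟩, h'⟩ := h
      exact .cons p h (ih h')
  · intro h
    induction h with
    | nil => rfl
    | cons p h _ ih => exact ⟨_, ⟨p, _, h, rfl⟩, ih⟩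

theorem mem_sys_traces_iff {π : List (Event P Var Val Op Ret)} :
    π ∈ I.sys.traces ↔ ∃ q, I.SysRun (fun _ => none) π q :=
  exists_congr fun _ => sys_run_iff

theorem SysRun.append_iff {q q' : I.SysState} {π π' : List (Event P Var Val Op Ret)} :
    I.SysRun q (π ++ π') q' ↔ ∃ r, I.SysRun q π r ∧ I.SysRun r π' q' := by
  refine sys_run_iff.symm.trans (LTS.run_append.trans ?_)
  exact exists_congr fun _ => and_congr sys_run_iff sys_run_iff

theorem SysRun.singleton {q : I.SysState} {e : Event P Var Val Op Ret} {p : P}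
    {r : Option (Σ o : Op, (I o p).State)} (h : I.ProcStep p (q p) e r) :
    I.SysRun q [e] (Function.update q p r) :=
  .cons p h (.nil _)

/-- After a run, the last object event of every process that is not idle is an invocation. -/
theorem SysRun.getLast?_isInv {π : List (Event P Var Val Op Ret)} {q : I.SysState}
    (h : I.SysRun (fun _ => none) π q) (p : P) (hp : q p ≠ none) :
    ∃ e, (restrictProc (restrictObj π) p).getLast? = some e ∧ e.IsInv := by
  induction π using List.reverseRecOn generalizing q with
  | nil =>
    cases h
    exact absurd rfl hp
  | append_singleton π e ih =>
    obtain ⟨q₁, h₁, h₂⟩ := append_iff.1 h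
    obtain _ | ⟨p', hstep, _ | _⟩ := h₂
    have ih := ih h₁
    rw [restrictObj_append]
    by_cases hpp : p = p'
    · subst hpp
      simp only [Function.update_self] at hp
      generalize hx : q₁ p = x at hstep
      cases hstep with
      | invoke o => exact ⟨⟨p, .inv o⟩, by simp [restrictProc, restrictObj, Event.obj?], o, rfl⟩
      | memory o q q' e h =>
        rw [restrictObj_cons_mem, show restrictObj [] = [] from rfl, List.append_nil]
        exact ih (by simp [hx])
      | respond => exact absurd rfl hp
    · rw [Function.update_of_ne hpp] at hp
      have : restrictProc (restrictObj π ++ restrictObj [e]) p = restrictProc (restrictObj π) p := by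
        generalize q₁ p' = x at hstep
        cases hstep <;>
          simp [restrictProc, restrictObj, Event.obj?, List.filterMap_cons, Ne.symm hpp]
      rw [this]
      exact ih hp

/-- No process is active after a run with a complete history. -/
theorem SysRun.eq_idle {π : List (Event P Var Val Op Ret)} {q : I.SysState}
    (h : I.SysRun (fun _ => none) π q) (hc : IsCompleteHist (restrictObj π)) :
    q = fun _ => none := by
  funext p
  by_contra hp
  obtain ⟨e, he, o, ho⟩ := h.getLast?_isInv p hp
  obtain ⟨r, hr⟩ := hc.2 p e he
  rw [ho] at hr
  cases hr

/-- When all processes are idle, the first step can only be an invocation. -/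
theorem SysRun.eq_nil_of_idle {π : List (Event P Var Val Op Ret)} {q : I.SysState}
    (h : I.SysRun (fun _ => none) π q) (hπ : restrictObj π = []) : π = [] := by
  cases h with
  | nil => rfl
  | cons p hstep _ =>
    cases hstep
    simp [restrictObj_cons_obj] at hπ

/-- Any step of another process would begin with an invocation, which `hπ` excludes. After the
response all processes are idle, so nothing follows it. -/
theorem SysRun.exists_run_of_active {π : List (Event P Var Val Op Ret)} {p : P} {o : Op}
    {s : (I o p).State} {q : I.SysState} {u : Ret}
    (h : I.SysRun (Function.update (fun _ => none) p (some ⟨o, s⟩)) π q)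
    (hπ : restrictObj π = [⟨p, .res u⟩]) :
    ∃ (σ : List (MemEvent P Var Val)) (s' : (I o p).State),
      π = σ.map .mem ++ [.obj ⟨p, .res u⟩] ∧
      (I o p).Run s (σ.map .mem ++ [.obj ⟨p, .res u⟩]) s' := by
  induction π generalizing s with
  | nil => simp [restrictObj] at hπ
  | cons e π ih =>
    obtain _ | ⟨p', hstep, h'⟩ := h
    have active : p' = p ∨ ∃ o, e = .obj ⟨p', .inv o⟩ := by
      by_cases hpp : p' = p
      · exact .inl hpp
      · rw [Function.update_of_ne hpp] at hstep
        cases hstep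
        exact .inr ⟨_, rfl⟩
    rcases active with rfl | ⟨o', rfl⟩
    · rw [Function.update_idem] at h'
      rw [Function.update_self] at hstep
      cases hstep with
      | memory _ _ s₂ e' hs =>
        obtain ⟨σ, s', rfl, hrun⟩ := ih h' hπ
        exact ⟨e' :: σ, s', rfl, s₂, hs, hrun⟩
      | respond _ _ s₂ u' hs =>
        rw [restrictObj_cons_obj] at hπ
        simp only [List.cons.injEq, ObjEvent.mk.injEq, ObjAction.res.injEq, true_and] at hπ
        obtain ⟨rfl, hπ⟩ := hπ
        rw [Function.update_eq_self_iff.2 rfl] at h'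
        obtain rfl := h'.eq_nil_of_idle hπ
        exact ⟨[], s₂, rfl, s₂, hs, rfl⟩
    · simp [restrictObj_cons_obj] at hπ

/-- A run of the system that performs a single operation is a run of that operation. -/
theorem SysRun.exists_run_of_invRes {π : List (Event P Var Val Op Ret)} {p : P} {o : Op}
    {q : I.SysState} {u : Ret}
    (h : I.SysRun (fun _ => none) π q) (hπ : restrictObj π = invRes p o u) :
    ∃ s, (I o p).Run (I o p).init ((restrictMem π).map .mem ++ [.obj ⟨p, .res u⟩]) s := by
  cases h with
  | nil => simp [restrictObj, invRes] at hπ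
  | cons p' hstep h' =>
    cases hstep
    rw [restrictObj_cons_obj] at hπ
    simp only [invRes, List.cons.injEq, ObjEvent.mk.injEq, ObjAction.inv.injEq] at hπ
    obtain ⟨⟨rfl, rfl⟩, hπ⟩ := hπ
    obtain ⟨σ, s, rfl, hrun⟩ := h'.exists_run_of_active hπ
    refine ⟨s, ?_⟩
    rw [restrictMem_cons_obj, restrictMem_append, restrictMem_map_mem]
    simpa [restrictMem, Event.mem?, List.filterMap_cons] using hrun

theorem SysRun.map_mem {p : P} {o : Op} {s s' : (I o p).State}
    {σ : List (MemEvent P Var Val)} (h : (I o p).Run s (σ.map .mem) s') {q : I.SysState}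
    (hq : q p = some ⟨o, s⟩) :
    I.SysRun q (σ.map .mem) (Function.update q p (some ⟨o, s'⟩)) := by
  induction σ generalizing s q with
  | nil =>
    cases h
    rw [← hq, Function.update_eq_self]
    exact .nil q
  | cons e σ ih =>
    obtain ⟨s₁, h₁, h₂⟩ := h
    have hstep : I.ProcStep p (q p) (.mem e) (some ⟨o, s₁⟩) := hq ▸ .memory o s s₁ e h₁
    have := ih h₂ (Function.update_self p (some ⟨o, s₁⟩) q)
    rw [Function.update_idem] at this
    exact .cons p hstep this

theorem SysRun.map_mem_respond {p : P} {o : Op} {s s' : (I o p).State}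
    {σ : List (MemEvent P Var Val)} {u : Ret}
    (h : (I o p).Run s (σ.map .mem ++ [.obj ⟨p, .res u⟩]) s') {q : I.SysState}
    (hq : q p = some ⟨o, s⟩) :
    I.SysRun q (σ.map .mem ++ [.obj ⟨p, .res u⟩]) (Function.update q p none) := by
  obtain ⟨s₁, h₁, h₂⟩ := LTS.run_append.1 h
  have := SysRun.singleton (q := Function.update q p (some ⟨o, s₁⟩)) (p := p)
    (e := .obj ⟨p, .res u⟩) (r := none) (by
      rw [Function.update_self]
      exact .respond o s₁ s' u (LTS.run_singleton.1 h₂))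
  rw [Function.update_idem] at this
  exact append_iff.2 ⟨_, map_mem h₁ hq, this⟩

/-- A complete operation of `p₂` can be scheduled in the middle of an operation of `p₁`. -/
theorem exists_sysRun_nested {p₁ p₂ : P} (hp : p₁ ≠ p₂) {o₁ o₂ : Op} {u₁ u₂ : Ret}
    {α β τ : List (MemEvent P Var Val)} {s₁ : (I o₁ p₁).State} {s₂ : (I o₂ p₂).State}
    (h₁ : (I o₁ p₁).Run (I o₁ p₁).init ((α ++ β).map .mem ++ [.obj ⟨p₁, .res u₁⟩]) s₁)
    (h₂ : (I o₂ p₂).Run (I o₂ p₂).init (τ.map .mem ++ [.obj ⟨p₂, .res u₂⟩]) s₂) :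
    ∃ π q, I.SysRun (fun _ => none) π q ∧ restrictMem π = α ++ τ ++ β ∧
      restrictObj π = [⟨p₁, .inv o₁⟩, ⟨p₂, .inv o₂⟩, ⟨p₂, .res u₂⟩, ⟨p₁, .res u₁⟩] := by
  rw [List.map_append, List.append_assoc] at h₁
  obtain ⟨s, hα, hβ⟩ := LTS.run_append.1 h₁
  have r₁ : I.SysRun (fun _ => none) [.obj ⟨p₁, .inv o₁⟩] _ := .singleton (.invoke (p := p₁) o₁)
  have r₂ := SysRun.map_mem hα (Function.update_self p₁ _ (fun _ => none))
  rw [Function.update_idem] at r₂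
  set q₂ : I.SysState := Function.update (fun _ => none) p₁ (some ⟨o₁, s⟩) with hq₂
  have hidle : q₂ p₂ = none := Function.update_of_ne hp.symm _ _
  have invoke : I.ProcStep p₂ (q₂ p₂) (.obj ⟨p₂, .inv o₂⟩) (some ⟨o₂, (I o₂ p₂).init⟩) :=
    hidle ▸ .invoke o₂
  have r₃ := SysRun.singleton invoke
  have r₄ := SysRun.map_mem_respond h₂ (Function.update_self p₂ _ q₂)
  -- The response of `p₂` restores `q₂`, from which `p₁` continues with `β`.
  rw [Function.update_idem, ← hidle, Function.update_eq_self] at r₄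
  have r₅ := SysRun.map_mem_respond hβ (q := q₂) (Function.update_self ..)
  refine ⟨_, _, SysRun.append_iff.2 ⟨_, r₁, SysRun.append_iff.2 ⟨_, r₂, SysRun.append_iff.2
    ⟨_, r₃, SysRun.append_iff.2 ⟨_, r₄, r₅⟩⟩⟩⟩, ?_, ?_⟩
  · simp only [restrictMem_append, restrictMem_map_mem]
    simp [restrictMem, Event.mem?, List.filterMap_cons]
  · simp only [restrictObj_append, restrictObj_map_mem]
    simp [restrictObj, Event.obj?]

end Implementation

end Implementations

/-! ### The main theorem -/

theorem mainTheorem3 {P Var Val : Type u} {Op : Type v} {Ret : Type w}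
    [Finite P] [DecidableEq P] [DecidableEq Var] [Zero Val]
    (O : ConcObject P Op Ret) (hdet : O.Deterministic)
    (o₁ o₂ : Op) (hnc : O.TwoSidedNonCommutative o₁ o₂)
    (M : MemoryModel P Var Val)
    (I : Implementation.{u, v, w, z} P Var Val Op Ret)
    (havail : I.SpecAvailable O) (hcons : I.Consistent O M) :
    ∃ (p₁ : P) (π₁ : List (Event P Var Val Op Ret)),
      π₁ ∈ (I o₁ p₁).traces ∧
      (M = SCM P Var Val →
        HasRMW (restrictMem π₁) ∨ ¬ IsRBW (restrictMem π₁)) ∧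
      (M = TSO P Var Val ∨ M = RA P Var Val →
        HasRMW (restrictMem π₁) ∨ ¬ IsLTF (restrictMem π₁)) := by
  obtain ⟨h₀, p₁, p₂, u₁, v₁, u₂, v₂, hh₀, hp, hu₁, hu₂, hspec₁, hspec₂⟩ := hnc
  obtain ⟨l₀, rfl⟩ := hh₀.exists_eq_seqHist
  have hcsh (p o u) : IsCSH (seqHist l₀ ++ invRes p o u) := by
    have := isCSH_seqHist (l₀ ++ [(p, o, u)])
    rwa [seqHist_append] at this
  have hpre₁ := O.prefix_closed _ hspec₁ _ (hcsh p₁ o₁ u₁) (List.prefix_append _ _)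
  have hpre₂ := O.prefix_closed _ hspec₂ _ (hcsh p₂ o₂ u₂) (List.prefix_append _ _)
  have hpre₀ := O.prefix_closed _ hpre₁ _ hh₀ (List.prefix_append _ _)
  obtain ⟨π₀, hπ₀, hm₀, ho₀⟩ := havail [] (seqHist l₀) (isCSH_seqHist []) hh₀ hpre₀ []
    ⟨_, rfl⟩ (MemoryModel.mem_otraces_iff.2 ⟨_, .refl _⟩) rfl
  rw [List.nil_append] at hπ₀ hm₀
  obtain ⟨m₀, hm₀'⟩ := MemoryModel.mem_otraces_iff.1 hm₀
  replace hm₀' : SCMRun (fun _ => 0) (restrictMem π₀) m₀ := SCM_orun_iff.1 hm₀'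
  -- Since `h₀` is complete, all processes are idle after `π₀`, so the extension is a run of the
  -- single operation from its initial state.
  have operation (p : P) (o : Op) (u : Ret) (hspec : seqHist l₀ ++ invRes p o u ∈ O.spec) :
      ∃ σ s m, (I o p).Run (I o p).init (σ.map .mem ++ [.obj ⟨p, .res u⟩]) s ∧
        SCMRun m₀ σ m := by
    obtain ⟨π, hπ, hm, ho⟩ := havail _ _ hh₀ (isCSH_seqHist [(p, o, u)]) hspec π₀ hπ₀ hm₀ ho₀
    obtain ⟨q, hq⟩ := Implementation.mem_sys_traces_iff.1 hπ
    obtain ⟨q₀, hq₀, hq⟩ := Implementation.SysRun.append_iff.1 hq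
    obtain rfl := hq₀.eq_idle (ho₀ ▸ hh₀.1)
    obtain ⟨s, hs⟩ := hq.exists_run_of_invRes ho
    obtain ⟨m, hm⟩ := MemoryModel.mem_otraces_iff.1 hm
    rw [restrictMem_append] at hm
    obtain ⟨m', hm', hm⟩ := SCMRun.append_iff.1 (SCM_orun_iff.1 hm)
    obtain rfl := hm'.unique hm₀'
    exact ⟨_, s, m, hs, hm⟩
  obtain ⟨σ₁, s₁, m₁, hrun₁, hscm₁⟩ := operation p₁ o₁ u₁ hpre₁
  obtain ⟨σ₂, s₂, m₂, hrun₂, hscm₂⟩ := operation p₂ o₂ u₂ hpre₂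
  have hproc₁ : ∀ e ∈ σ₁, e.proc = p₁ := fun e he =>
    Implementation.proc_eq_of_run hrun₁ (.mem e) (by simp [he])
  have hproc₂ : ∀ e ∈ σ₂, e.proc ≠ p₁ := fun e he h =>
    hp (h.symm.trans (Implementation.proc_eq_of_run hrun₂ (.mem e) (by simp [he])))
  -- This part of the argument holds for every memory model; only the construction of the merged
  -- trace depends on `M`.
  have no_merge {α β : List (MemEvent P Var Val)} (hσ : σ₁ = α ++ β) :
      restrictMem π₀ ++ (α ++ σ₂ ++ β) ∉ M.otraces := by
    intro hM
    subst hσ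
    obtain ⟨π, q, hq, hmem, hobj⟩ := Implementation.exists_sysRun_nested hp hrun₁ hrun₂
    obtain ⟨q₀, hq₀⟩ := Implementation.mem_sys_traces_iff.1 hπ₀
    obtain rfl := hq₀.eq_idle (ho₀ ▸ hh₀.1)
    obtain ⟨h', hh', hlin⟩ := hcons
      (seqHist l₀ ++ [⟨p₁, .inv o₁⟩, ⟨p₂, .inv o₂⟩, ⟨p₂, .res u₂⟩, ⟨p₁, .res u₁⟩])
      ⟨π₀ ++ π, (Implementation.mem_sys_traces_iff (π := π₀ ++ π)).2
        ⟨q, Implementation.SysRun.append_iff.2 ⟨_, hq₀, hq⟩⟩, by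
        rwa [List.nil_append, restrictMem_append, hmem], by
        rw [restrictObj_append, ho₀, hobj]⟩
      -- The overlapping history has the same restriction to each process as the sequential one in
      -- which `o₁` precedes `o₂`.
      (isCompleteHist_of_forall fun p => ⟨l₀ ++ [(p₁, o₁, u₁), (p₂, o₂, u₂)], by
        by_cases h₁ : p₁ = p
        · subst h₁
          simp [restrictProc, seqHist_append, seqHist_cons, seqHist_nil, hp.symm]
        · by_cases h₂ : p₂ = p <;>
            simp [restrictProc, seqHist_append, seqHist_cons, seqHist_nil, h₁, h₂]⟩)
    rcases hlin.overlapping hp hh₀ (O.isCSH_of_mem _ hh') with rfl | rfl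
    · exact hu₂ (hdet.res_unique hh' hspec₁)
    · exact hu₁ (hdet.res_unique hh' hspec₂)
  have hmem : restrictMem (σ₁.map .mem ++ [(.obj ⟨p₁, .res u₁⟩ : Event P Var Val Op Ret)]) = σ₁ := by
    rw [restrictMem_append, restrictMem_map_mem]
    exact List.append_nil σ₁
  refine ⟨p₁, _, ⟨s₁, hrun₁⟩, ?_, ?_⟩ <;> rw [hmem]
  · rintro rfl
    by_contra! h
    obtain ⟨α, β, m', hσ, hm'⟩ := hscm₁.merge hscm₂ h.1 h.2
    exact no_merge hσ (MemoryModel.mem_otraces_iff.2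
      ⟨m', SCM_orun_iff.2 (SCMRun.append_iff.2 ⟨_, hm₀', hm'⟩)⟩)
  · intro hM
    by_contra! h
    rcases hM with rfl | rfl
    · obtain ⟨α, β, hσ, hm⟩ := TSO_merge hm₀' hscm₁ hscm₂ hproc₁ hproc₂ h.1 h.2
      exact no_merge hσ hm
    · obtain ⟨α, β, hσ, hm⟩ := RA_merge hm₀' hscm₁ hscm₂ hproc₁ hproc₂ h.1 h.2
      exact no_merge hσ hm
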